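/- **Setting.** For odd $d$ let $\mathbb C^d$ have the orthonormal basis $|n\rangle$, $n\in L_d=\{-\frac{d-1}2,\dots,\frac{d-1}2\}$, and let $\hat H_d=\frac{2\pi}{\sqrt d}\sum_{n\in L_d}n|n\rangle\langle n|$ and $|\theta_k\rangle=\frac1{\sqrt d}\sum_{n\in L_d}e^{-2\pi i kn/d}|n\rangle$ ($k\in L_d$). Let $\theta_3(z,\tau)=\sum_{m\in\mathbb Z}e^{i\pi\tau m^2+2\pi i mz}$. For $\xi^2,\sigma_m^2>0$ and $n_0\in\mathbb Z$ let $$|\Psi_0\rangle=\sum_{k\in L_d}\mathcal N\,\theta_3\!\left(\tfrac kd,\tfrac{i\xi^2}{d}\right)e^{2\pi i n_0k/d}|\theta_k\rangle,\qquad \hat\Omega(x)=\frac{1}{d^{1/4}\sqrt{\theta_3(0,2i\sigma_m^2/d)}}\sum_{k\in L_d}\theta_3\!\left(\tfrac{k-x\sqrt d}{d},\tfrac{i\sigma_m^2}{d}\right)|\theta_k\rangle\langle\theta_k|,$$ where $\mathcal N=\sqrt{2/d}\,\big(\theta_3(0,\tfrac{i\xi^2}{2d})\theta_3(0,\tfrac{id\xi^2}{2})+\theta_3(\tfrac12,\tfrac{i\xi^2}{2d})\theta_3(\tfrac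 d2,\tfrac{id\xi^2}{2})\big)^{-1/2}$ is the normalization constant. The clock is measured $J$ times, the $j$-th measurement coming a time $\delta_j/\sqrt d$ after the preceding one, with $\delta_j=\frac12$ for all $j$. The outcomes $\widetilde\xi_1,\dots,\widetilde\xi_J\in[-\frac{\sqrt d}2,\frac{\sqrt d}2]$ have joint density $$f(\widetilde\xi_1,\dots,\widetilde\xi_J)=\big\|\hat\Omega(\widetilde\xi_J)e^{-i\hat H_d\delta_J/\sqrt d}\cdots\hat\Omega(\widetilde\xi_1)e^{-i\hat H_d\delta_1/\sqrt d}|\Psi_0\rangle\big\|^2 ,$$ and $\langle\cdot\rangle$ is the integral against $f$ over $[-\frac{\sqrt d}2,\frac{\sqrt d}2]^J$. Let $S=\theta_3(\frac1{2d},\frac{i}{2\xi^2d})\theta_3(\frac12,\frac{id}{2\xi^2})+\theta_3(\frac12-\frac1{2d},\frac{i}{2\xi^2d})\theta_3(0,\frac{id}{2\xi^2})$ and $$C_1=\frac{S}{\theta_3(0,\frac{i}{2\xi^2d})\theta_3(0,\frac{id}{2\xi^2})+\theta_3(\frac12,\frac{i}{2\xi^2d})\theta_3(\frac12,\frac{id}{2\xi^2})},\qquad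 C_2=\frac{\theta_3(\frac{i\sigma_m^2}{d},\frac{2i\sigma_m^2}{d})}{\theta_3(0,\frac{2i\sigma_m^2}{d})}e^{-\pi\sigma_m^2/d}.$$ The backaction factor $C_3=C_3(I)$ is the expectation of $\prod_{j=1}^I\big(1-(1-e^{2\pi i\delta_j})\mathbf 1_{p_j=\frac{d-1}2}\big)$ for the random walk $p_1,\dots,p_I$ on $L_d$ (the integers modulo $d$) with initial distribution $p\mapsto\theta_3(\frac{p-n_0+1}d,\frac i{\xi^2d})\,\theta_3(\frac{p-n_0}d,\frac i{\xi^2d})\big/(\frac d2S)$ and jump distribution $q\mapsto\theta_3(\frac qd,\frac i{2\sigma_m^2d})\big/\big(\sqrt{2\sigma_m^2d}\;\theta_3(0,\frac{2i\sigma_m^2}d)\big)$. **Claim.** Let $c_1,c_2,t>0$, $-1<\alpha<1$, $-\frac12<\beta<0$, $\gamma\in(\frac12,1)$, and take $\xi^2=c_1d^\alpha$, $\sigma_m^2=c_2d^\beta$. As $d\to\infty$ through odd integers, uniformly over the integers $n_0$ with $|n_0|<\gamma\frac d2-\frac12$ (which may depend on $d$), the integers $I$ with $2\le I\le t\sqrt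 d$, and the integers $J\ge I$, the following hold. Put $$E_d=d^{\beta/2+1/2}\,e^{-\frac{\pi c_2(1-\gamma)^2}{2t}d^{1/2+\beta}}+d^{-1}\,e^{-\frac{\pi c_1}{4}\left(\gamma-\frac{2|n_0|}d\right)^2d^{1+\alpha}} .$$ 1. $\displaystyle\left\langle\exp\left(-\frac{2\pi i\widetilde\xi_I}{\sqrt d}\right)\right\rangle=e^{-\frac{2\pi i}d\sum_{j=1}^I\delta_j}\;e^{-\frac{\pi c_1}2d^{\alpha-1}-\frac{\pi c_2}2d^{\beta-1}}\Big(1+\mathcal O\big(E_d+e^{-\frac{\pi}{2c_1}d^{1-\alpha}}\big)\Big)$, where $e^{-\frac{2\pi i}d\sum_{j=1}^I\delta_j}=e^{-\pi iI/d}$. 2. $\displaystyle\left\langle\exp\left(-\frac{2\pi i\widetilde\xi_I}{\sqrt d}\right)\right\rangle=e^{-\frac{2\pi i}d\sum_{j=1}^I\delta_j}\,C_1C_2C_3$. 3. $C_3=1+\mathcal O(E_d)$. The implied constants depend only on $c_1,c_2,\alpha,\beta,\gamma,t$. -/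

import Mathlib

open MeasureTheory
open scoped Matrix

noncomputable section

namespace QuasiIdealClock

/-- The labels `-(d-1)/2, …, (d-1)/2` (for odd `d`) of both the energy and the time eigenbasis. -/
abbrev Label (d : ℕ) : Type :=
  ↥(Finset.Icc (-(((d : ℤ) - 1) / 2)) (((d : ℤ) - 1) / 2))

/-- `θ₃(z, i s)` for real `z` and real `s > 0`. It is real, see `theta_ofReal`. -/
def theta (z s : ℝ) : ℝ := (jacobiTheta₂ (z : ℂ) (Complex.I * (s : ℂ))).re

lemma theta_ofReal (z s : ℝ) :
    (theta z s : ℂ) = jacobiTheta₂ (z : ℂ) (Complex.I * (s : ℂ)) := by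
  unfold theta
  apply Complex.conj_eq_iff_re.mp
  rw [jacobiTheta₂_conj]
  simp

/-- The Hamiltonian `H = (2π/√d) ∑ n |n⟩⟨n|`, in the energy eigenbasis. -/
def hamiltonian (d : ℕ) : Matrix (Label d) (Label d) ℂ :=
  Matrix.diagonal fun n => ((2 * Real.pi / Real.sqrt d * ((n : ℤ) : ℝ) : ℝ) : ℂ)

/-- The free evolution `exp(-i τ H)` during a time `τ`. -/
def evolution (d : ℕ) (τ : ℝ) : Matrix (Label d) (Label d) ℂ :=
  NormedSpace.exp ((-(Complex.I * (τ : ℂ))) • hamiltonian d)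

/-- The time eigenstate `|θ_k⟩ = d^{-1/2} ∑ₙ e^{-2πikn/d} |n⟩`. -/
def timeState (d : ℕ) (k : Label d) : Label d → ℂ := fun n =>
  ((1 / Real.sqrt d : ℝ) : ℂ) *
    Complex.exp (-(2 * Real.pi * Complex.I * ((k : ℤ) : ℂ) * ((n : ℤ) : ℂ) / (d : ℂ)))

/-- The coefficient of the initial quasi-ideal state on `|θ_k⟩`. -/
def initialCoeff (d : ℕ) (ξsq : ℝ) (n₀ : ℤ) (k : Label d) : ℂ :=
  ((Real.sqrt (2 / d) /
      Real.sqrt (theta 0 (ξsq / (2 * d)) * theta 0 (d * ξsq / 2) +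
        theta (1 / 2) (ξsq / (2 * d)) * theta (d / 2) (d * ξsq / 2)) *
      theta (((k : ℤ) : ℝ) / d) (ξsq / d) : ℝ) : ℂ) *
    Complex.exp (2 * Real.pi * Complex.I * (n₀ : ℂ) * ((k : ℤ) : ℂ) / (d : ℂ))

/-- The initial quasi-ideal state `|Ψ₀⟩`, of squared width `ξsq` and mean energy label `n₀`. -/
def initialState (d : ℕ) (ξsq : ℝ) (n₀ : ℤ) : Label d → ℂ :=
  ∑ k : Label d, initialCoeff d ξsq n₀ k • timeState d k

/-- The eigenvalue `Ω_k(x)` of the Kraus operator of outcome `x` on `|θ_k⟩`. -/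
def krausCoeff (d : ℕ) (σsq x : ℝ) (k : Label d) : ℝ :=
  1 / Real.sqrt (theta 0 (2 * σsq / d)) * (1 / (d : ℝ) ^ (1 / 4 : ℝ)) *
    theta ((((k : ℤ) : ℝ) - x * Real.sqrt d) / d) (σsq / d)

/-- The Kraus operator `Ω(x) = ∑ₖ Ω_k(x) |θ_k⟩⟨θ_k|` of outcome `x`. -/
def kraus (d : ℕ) (σsq x : ℝ) : Matrix (Label d) (Label d) ℂ :=
  ∑ k : Label d, (krausCoeff d σsq x k : ℂ) •
    Matrix.vecMulVec (timeState d k) (star (timeState d k))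

/-- The unnormalized state after `J` measurements with outcomes `x 0, …, x (J-1)`, where the `j`-th
measurement (`j = 1, …, J`) is preceded by a free evolution during a time `δ j / √d`. -/
def measuredState (d : ℕ) (ξsq σsq : ℝ) (n₀ : ℤ) (δ : ℕ → ℝ) :
    (J : ℕ) → (Fin J → ℝ) → (Label d → ℂ)
  | 0, _ => initialState d ξsq n₀
  | J + 1, x =>
      kraus d σsq (x (Fin.last J)) *ᵥ
        (evolution d (δ (J + 1) / Real.sqrt d) *ᵥ
          measuredState d ξsq σsq n₀ δ J (Fin.init x))

/-- The joint probability density of the `J` outcomes (a squared Euclidean norm). -/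
def outcomeDensity (d : ℕ) (ξsq σsq : ℝ) (n₀ : ℤ) (δ : ℕ → ℝ) (J : ℕ) (x : Fin J → ℝ) : ℝ :=
  ‖WithLp.toLp 2 (measuredState d ξsq σsq n₀ δ J x)‖ ^ 2

/-- The expectation of `exp(-2πi x_i / √d)` over the outcomes of the `J` measurements, each of which
ranges over `[-√d/2, √d/2]`. -/
def clockMoment (d : ℕ) (ξsq σsq : ℝ) (n₀ : ℤ) (δ : ℕ → ℝ) (J : ℕ) (i : Fin J) : ℂ :=
  ∫ x in Set.Icc (fun _ : Fin J => -(Real.sqrt d / 2)) (fun _ : Fin J => Real.sqrt d / 2),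
    Complex.exp (-(2 * Real.pi * Complex.I * ((x i : ℝ) : ℂ) / ((Real.sqrt d : ℝ) : ℂ))) *
      (outcomeDensity d ξsq σsq n₀ δ J x : ℂ)

/-- `θ₃(1/(2d), i/(2ξ²d)) θ₃(1/2, id/(2ξ²)) + θ₃(1/2 - 1/(2d), i/(2ξ²d)) θ₃(0, id/(2ξ²))`. -/
def overlapSum (d : ℕ) (ξsq : ℝ) : ℝ :=
  theta (1 / (2 * d)) (1 / (2 * ξsq * d)) * theta (1 / 2) (d / (2 * ξsq)) +
    theta (1 / 2 - 1 / (2 * d)) (1 / (2 * ξsq * d)) * theta 0 (d / (2 * ξsq))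

/-- The wavefunction factor `C₁`. -/
def waveFactor (d : ℕ) (ξsq : ℝ) : ℝ :=
  overlapSum d ξsq /
    (theta 0 (1 / (2 * ξsq * d)) * theta 0 (d / (2 * ξsq)) +
      theta (1 / 2) (1 / (2 * ξsq * d)) * theta (1 / 2) (d / (2 * ξsq)))

/-- The imprecision factor `C₂ = θ₃(iσ²/d, 2iσ²/d) / θ₃(0, 2iσ²/d) · exp(-πσ²/d)`. -/
def imprecisionFactor (d : ℕ) (σsq : ℝ) : ℂ :=
  jacobiTheta₂ (Complex.I * ((σsq / d : ℝ) : ℂ)) (Complex.I * ((2 * σsq / d : ℝ) : ℂ)) /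
      jacobiTheta₂ 0 (Complex.I * ((2 * σsq / d : ℝ) : ℂ)) *
    Complex.exp (-((Real.pi * σsq / d : ℝ) : ℂ))

/-- The distribution of the first position of the random walk. -/
def walkInitial (d : ℕ) (ξsq : ℝ) (n₀ : ℤ) (p : Label d) : ℝ :=
  theta ((((p : ℤ) - n₀ + 1 : ℤ) : ℝ) / d) (1 / (ξsq * d)) *
      theta ((((p : ℤ) - n₀ : ℤ) : ℝ) / d) (1 / (ξsq * d)) /
    ((d : ℝ) / 2 * overlapSum d ξsq)

/-- The probability of a jump of size `q` of the random walk on the ring of integers mod `d`. -/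
def walkJump (d : ℕ) (σsq : ℝ) (q : ℤ) : ℝ :=
  theta ((q : ℝ) / d) (1 / (2 * σsq * d)) /
    (Real.sqrt (2 * σsq * d) * theta 0 (2 * σsq / d))

/-- The backaction factor `C₃` for the measurement of index `N + 1`: the expectation of
`∏ⱼ (1 - (1 - e^{2πi δⱼ}) 1{pⱼ = (d-1)/2})` over the random walk `p₁, …, p_{N+1}`. -/
def backactionFactor (d : ℕ) (ξsq σsq : ℝ) (n₀ : ℤ) (δ : ℕ → ℝ) (N : ℕ) : ℂ :=
  ∑ p : Fin (N + 1) → Label d,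
    ((walkInitial d ξsq n₀ (p 0) *
        ∏ j : Fin N, walkJump d σsq ((p j.succ : ℤ) - (p j.castSucc : ℤ)) : ℝ) : ℂ) *
      ∏ j : Fin (N + 1),
        (1 - (1 - Complex.exp (2 * Real.pi * Complex.I * (δ ((j : ℕ) + 1) : ℂ))) *
          (if (p j : ℤ) = ((d : ℤ) - 1) / 2 then 1 else 0))

/-- The bound (up to a constant) on the deviation of `C₃` from `1`. -/
def backactionError (c₁ c₂ α β γ t : ℝ) (n₀ : ℤ) (d : ℕ) : ℝ :=
  (d : ℝ) ^ (β / 2 + 1 / 2) *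
      Real.exp (-(Real.pi * c₂ * (1 - γ) ^ 2 / (2 * t)) * (d : ℝ) ^ (1 / 2 + β)) +
    (d : ℝ) ^ (-1 : ℝ) *
      Real.exp (-(Real.pi * c₁ * (γ - 2 * |(n₀ : ℝ)| / d) ^ 2 / 4) * (d : ℝ) ^ (1 + α))

end QuasiIdealClock

end

/-! In the energy basis the Kraus operators are circulant: the entry at (n, n') is a Fourier series
in the outcome x with frequencies congruent to n - n' mod d (`hasSum_kraus`). By orthogonality of
characters, integrating one outcome against e^{-2πijx/√d} turns the form Σ a_p conj(ψ_p) ψ_{p+i} of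
the state after a measurement into a form of the same kind, with shift i+j and a convolved weight,
of the state before it (`setIntegral_shiftForm_kraus`). The outcomes are integrated out from the
last to the first. The density is the form with i = 0, a = 1. Outcomes after the I-th disappear
because the kernel for j = 0 is a probability distribution. The I-th one raises the shift to 1 and
yields C₂. Every earlier one applies a transition of the random walk. Free evolution multiplies
conj(ψ_p) ψ_{p+1} by e^{-2πiδ/d}, and by a further e^{2πiδ} at the top level, where p+1 wraps to the
bottom. The overlap of the initial state with its shift is C₁ times the initial law of the walk.
This is the exact factorization `clockMoment_eq`.

For δ = 1/2 the step factors are ±1, so |C₃ - 1| is at most twice the probability of visiting the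
top level. A symmetrised exponential of p + 1/2 grows at most by a factor e^v per step, with no
other constant, since wrapping around the ring only lowers it. Hence a supermartingale bound holds
over all steps at once (`norm_one_sub_walkValue_le`); optimising the rate gives the first term of
E_d. The start of the walk has Gaussian tails about n₀. Cutting at γd/2 and at (1+γ)d/4 gives the
second term: beyond γd/2 the tail supplies the stated exponential, and either the remaining distance
to the edge or the additional tail supplies a surplus that absorbs the powers of d
(`exists_norm_backactionFactor_sub_one_le`).

For C₁ and C₂, each theta function, after Poisson summation where its parameter is small, is reduced
to its dominant term with an exponentially small error; these errors fit into E_d and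
e^{-πd^{1-α}/(2c₁)}. -/

noncomputable section

namespace QuasiIdealClock

open Complex (I)
open scoped Real ComplexConjugate

/-- The character `x ↦ exp (2πix)`. -/
def cis (x : ℝ) : ℂ := Complex.exp (((2 * π * x : ℝ) : ℂ) * I)

lemma cis_add (x y : ℝ) : cis (x + y) = cis x * cis y := by
  rw [cis, cis, cis, ← Complex.exp_add]; push_cast; ring_nf

lemma cis_neg (x : ℝ) : cis (-x) = conj (cis x) := by
  rw [cis, cis, ← Complex.exp_conj, map_mul, Complex.conj_ofReal, Complex.conj_I]
  push_cast; ring_nf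

lemma cis_zero : cis 0 = 1 := by simp [cis]

lemma norm_cis (x : ℝ) : ‖cis x‖ = 1 := Complex.norm_exp_ofReal_mul_I _

lemma cis_int (n : ℤ) : cis n = 1 := by
  rw [cis, Complex.exp_eq_one_iff]
  exact ⟨n, by push_cast; ring⟩

lemma cis_add_int (x : ℝ) (n : ℤ) : cis (x + n) = cis x := by
  rw [cis_add, cis_int, mul_one]

lemma cis_eq_one_iff (x : ℝ) : cis x = 1 ↔ ∃ n : ℤ, x = n := by
  rw [cis, Complex.exp_eq_one_iff]
  refine exists_congr fun n => ⟨fun h => ?_, fun h => by rw [h]; push_cast; ring⟩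
  have h2 : (2 * π * I : ℂ) * ((x : ℂ) - n) = 0 := by
    push_cast at h; linear_combination h
  have h3 := (mul_eq_zero.mp h2).resolve_left Complex.two_pi_I_ne_zero
  exact_mod_cast sub_eq_zero.mp h3

lemma cis_half : cis (1 / 2) = -1 := by
  rw [cis, show 2 * π * (1 / 2) = π by ring, Complex.exp_pi_mul_I]

lemma continuous_cis : Continuous cis := by
  unfold cis; fun_prop

/-! ### The theta series -/

lemma im_I_mul (s : ℝ) : (I * (s : ℂ)).im = s := by simp

lemma hasSum_theta {s : ℝ} (hs : 0 < s) (z : ℝ) :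
    HasSum (fun m : ℤ => ((Real.exp (-(π * s * m ^ 2)) : ℝ) : ℂ) * cis (m * z))
      (theta z s : ℂ) := by
  rw [theta_ofReal]
  have h := hasSum_jacobiTheta₂_term (z : ℂ) (τ := I * (s : ℂ)) (by rwa [im_I_mul])
  refine h.congr_fun fun m => ?_
  rw [jacobiTheta₂_term, cis, Complex.ofReal_exp, ← Complex.exp_add]
  congr 1
  push_cast
  linear_combination (-(π : ℂ) * m ^ 2 * s) * Complex.I_mul_I

lemma summable_exp_sq {s : ℝ} (hs : 0 < s) :
    Summable fun m : ℤ => Real.exp (-(π * s * m ^ 2)) := by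
  have := (hasSum_theta hs 0).summable.norm
  refine this.congr fun m => ?_
  rw [norm_mul, norm_cis, mul_one, Complex.norm_real, Real.norm_of_nonneg (Real.exp_pos _).le]

lemma hasSum_theta_zero {s : ℝ} (hs : 0 < s) :
    HasSum (fun m : ℤ => Real.exp (-(π * s * m ^ 2))) (theta 0 s) := by
  have := hasSum_theta hs 0
  simp only [mul_zero, cis_zero, mul_one] at this
  exact_mod_cast this

/-- Poisson summation, in the form of Jacobi's functional equation. The terms are now positive,
which yields positivity of θ₃ and its leading term for small s. -/
lemma hasSum_exp_shift {s : ℝ} (hs : 0 < s) (z : ℝ) :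
    HasSum (fun l : ℤ => Real.exp (-(π / s * (l + z) ^ 2))) (√s * theta z s) := by
  have hsc : (s : ℂ) ≠ 0 := by exact_mod_cast hs.ne'
  have hτ : (I * (s : ℂ)) ≠ 0 := mul_ne_zero Complex.I_ne_zero hsc
  have him : 0 < (-1 / (I * (s : ℂ))).im := by
    have : -1 / (I * (s : ℂ)) = I * ((1 / s : ℝ) : ℂ) := by
      push_cast; field_simp; linear_combination -Complex.I_sq
    rw [this, im_I_mul]; positivity
  have h := (hasSum_jacobiTheta₂_term ((z : ℂ) / (I * s)) him).mul_left
    (Complex.exp (-π * I * z ^ 2 / (I * s)))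
  have hf := jacobiTheta₂_functional_equation (z : ℂ) (I * s)
  have hsq : (-I * (I * (s : ℂ))) ^ (1 / 2 : ℂ) = ((√s : ℝ) : ℂ) := by
    rw [show -I * (I * (s : ℂ)) = s by linear_combination (-(s : ℂ)) * Complex.I_mul_I,
      Real.sqrt_eq_rpow, Complex.ofReal_cpow hs.le]
    norm_num
  have hs0 : ((√s : ℝ) : ℂ) ≠ 0 := by exact_mod_cast (Real.sqrt_pos.mpr hs).ne'
  have hval : Complex.exp (-π * I * z ^ 2 / (I * s)) *
      jacobiTheta₂ ((z : ℂ) / (I * s)) (-1 / (I * s)) = ((√s * theta z s : ℝ) : ℂ) := by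
    rw [hsq] at hf
    push_cast
    rw [theta_ofReal, hf]
    field_simp
  rw [hval] at h
  have h' : HasSum (fun m : ℤ => Real.exp (-(π / s * (-(m : ℝ) + z) ^ 2))) (√s * theta z s) := by
    rw [← Complex.hasSum_ofReal]
    refine h.congr_fun fun m => ?_
    rw [jacobiTheta₂_term, ← Complex.exp_add, Complex.ofReal_exp]
    congr 1
    push_cast
    field_simp
    ring
  have := (Equiv.neg ℤ).hasSum_iff.mpr h'
  refine this.congr_fun fun m => ?_
  simp [Function.comp]

lemma theta_pos {s : ℝ} (hs : 0 < s) (z : ℝ) : 0 < theta z s := by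
  have h := hasSum_exp_shift hs z
  have : 0 < √s * theta z s := by
    rw [← h.tsum_eq]
    exact h.summable.tsum_pos (fun _ => (Real.exp_pos _).le) 0 (Real.exp_pos _)
  exact pos_of_mul_pos_right this (Real.sqrt_nonneg s)

lemma theta_le_theta_zero {s : ℝ} (hs : 0 < s) (z : ℝ) : theta z s ≤ theta 0 s := by
  have h := hasSum_theta hs z
  have h1 : ‖(theta z s : ℂ)‖ ≤ theta 0 s := by
    refine h.norm_le_of_bounded (hasSum_theta_zero hs) fun m => ?_
    rw [norm_mul, norm_cis, mul_one, Complex.norm_real, Real.norm_of_nonneg (Real.exp_pos _).le]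
  exact (le_abs_self _).trans (by simpa using h1)

lemma one_le_theta_zero {s : ℝ} (hs : 0 < s) : 1 ≤ theta 0 s := by
  have h := hasSum_theta_zero hs
  have := h.summable.le_tsum 0 fun _ _ => (Real.exp_pos _).le
  rw [h.tsum_eq] at this
  simpa using this

lemma abs_theta_sub_one_le {s : ℝ} (hs : 0 < s) (z : ℝ) :
    |theta z s - 1| ≤ theta 0 s - 1 := by
  have h := (hasSum_theta hs z).sub (hasSum_ite_eq (0 : ℤ) (1 : ℂ))
  have h0 := (hasSum_theta_zero hs).sub (hasSum_ite_eq (0 : ℤ) (1 : ℝ))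
  have h1 : ‖(theta z s : ℂ) - 1‖ ≤ theta 0 s - 1 := by
    refine h.norm_le_of_bounded h0 fun m => ?_
    by_cases hm : m = 0
    · simp [hm, cis_zero]
    · simp only [hm, if_false, sub_zero]
      rw [norm_mul, norm_cis, mul_one, Complex.norm_real, Real.norm_of_nonneg (Real.exp_pos _).le]
  have h2 : (theta z s : ℂ) - 1 = ((theta z s - 1 : ℝ) : ℂ) := by push_cast; ring
  rwa [h2, Complex.norm_real, Real.norm_eq_abs] at h1

lemma theta_neg (z s : ℝ) : theta (-z) s = theta z s := by
  simp [theta, jacobiTheta₂_neg_left]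

lemma theta_add_one (z s : ℝ) : theta (z + 1) s = theta z s := by
  simp [theta, jacobiTheta₂_add_left]

lemma theta_periodic (s : ℝ) : Function.Periodic (fun z => theta z s) 1 :=
  fun z => theta_add_one z s

lemma theta_add_int (z s : ℝ) (n : ℤ) : theta (z + n) s = theta z s := by
  simpa using (theta_periodic s).int_mul n z

lemma theta_zero_antitone {s u : ℝ} (hs : 0 < s) (h : s ≤ u) : theta 0 u ≤ theta 0 s := by
  refine hasSum_le (fun m => ?_) (hasSum_theta_zero (hs.trans_le h)) (hasSum_theta_zero hs)
  gcongr

lemma theta_zero_sub_one_le {s₀ s : ℝ} (hs₀ : 0 < s₀) (h : s₀ ≤ s) :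
    theta 0 s - 1 ≤ 2 / (1 - Real.exp (-(π * s₀))) * Real.exp (-(π * s)) := by
  have hs : 0 < s := hs₀.trans_le h
  have h1 := norm_jacobiTheta_sub_one_le (τ := I * (s : ℂ)) (by rwa [im_I_mul])
  have h3 : jacobiTheta (I * (s : ℂ)) = (theta 0 s : ℂ) := by
    rw [theta_ofReal, jacobiTheta_eq_jacobiTheta₂]; simp
  have h2 : (theta 0 s : ℂ) - 1 = ((theta 0 s - 1 : ℝ) : ℂ) := by push_cast; ring
  rw [h3, h2, im_I_mul, Complex.norm_real, Real.norm_eq_abs] at h1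
  refine (le_abs_self _).trans (h1.trans ?_)
  have h4 : 0 < 1 - Real.exp (-(π * s₀)) := by
    have : Real.exp (-(π * s₀)) < 1 := Real.exp_lt_one_iff.mpr (by nlinarith [Real.pi_pos])
    linarith
  rw [neg_mul]
  gcongr

lemma continuous_theta {s : ℝ} (hs : 0 < s) : Continuous fun z => theta z s := by
  refine continuous_iff_continuousAt.mpr fun z => ?_
  have h := continuousAt_jacobiTheta₂ (z : ℂ) (τ := I * (s : ℂ)) (by rwa [im_I_mul])
  have h2 : ContinuousAt (fun z : ℝ => ((z : ℂ), I * (s : ℂ))) z := by fun_prop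
  exact Complex.continuous_re.continuousAt.comp
    (ContinuousAt.comp (f := fun z : ℝ => ((z : ℂ), I * (s : ℂ))) (x := z) h h2)

/-! ### Labels -/

section Label

variable {d : ℕ}

lemma Label.bounds (hd : Odd d) (p : Label d) : -(d : ℤ) < 2 * (p : ℤ) ∧ 2 * (p : ℤ) < d := by
  obtain ⟨k, rfl⟩ := hd
  have := Finset.mem_Icc.mp p.2
  push_cast at this ⊢
  omega

/-- The label congruent to an integer modulo `d`. -/
def Label.ofInt (hd : Odd d) (m : ℤ) : Label d :=
  ⟨Int.bmod m d, by
    obtain ⟨k, rfl⟩ := hd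
    have h1 := Int.le_bmod (x := m) (m := 2 * k + 1) (by omega)
    have h2 := Int.bmod_lt (x := m) (m := 2 * k + 1) (by omega)
    rw [Finset.mem_Icc]
    push_cast at h1 h2 ⊢
    omega⟩

lemma Label.ofInt_eq (hd : Odd d) (m : ℤ) :
    ∃ l : ℤ, ((Label.ofInt hd m : Label d) : ℤ) = m + l * d :=
  ⟨-Int.bdiv m d, by
    have := Int.bmod_add_bdiv' m d
    change Int.bmod m d = _
    linarith⟩

lemma Label.eq_of_dvd (hd : Odd d) {p q : Label d} (h : (d : ℤ) ∣ (p : ℤ) - q) : p = q := by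
  have hp := p.bounds hd
  have hq := q.bounds hd
  have hd0 : (0 : ℤ) < d := by exact_mod_cast hd.pos
  have : (p : ℤ) - q = 0 := by
    refine Int.eq_zero_of_abs_lt_dvd h ?_
    rw [abs_lt]; omega
  exact Subtype.ext (by omega)

lemma Label.ofInt_coe (hd : Odd d) (p : Label d) : Label.ofInt hd p = p := by
  obtain ⟨l, hl⟩ := Label.ofInt_eq hd p
  exact Label.eq_of_dvd hd ⟨l, by rw [hl]; ring⟩

lemma Label.ofInt_eq_iff (hd : Odd d) (m : ℤ) (p : Label d) :
    Label.ofInt hd m = p ↔ (d : ℤ) ∣ m - p := by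
  obtain ⟨l, hl⟩ := Label.ofInt_eq hd m
  constructor
  · rintro rfl
    exact ⟨-l, by rw [hl]; ring⟩
  · rintro ⟨k, hk⟩
    exact Label.eq_of_dvd hd ⟨k + l, by rw [hl]; linear_combination hk⟩

/-- The cyclic shift of the labels. -/
def Label.shift (hd : Odd d) (i : ℤ) : Label d ≃ Label d where
  toFun p := Label.ofInt hd (p + i)
  invFun p := Label.ofInt hd (p - i)
  left_inv p := by
    obtain ⟨l, hl⟩ := Label.ofInt_eq hd (p + i)
    rw [Label.ofInt_eq_iff, hl]
    exact ⟨l, by ring⟩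
  right_inv p := by
    obtain ⟨l, hl⟩ := Label.ofInt_eq hd (p - i)
    rw [Label.ofInt_eq_iff, hl]
    exact ⟨l, by ring⟩

lemma Label.shift_eq (hd : Odd d) (i : ℤ) (p : Label d) :
    ∃ l : ℤ, ((Label.shift hd i p : Label d) : ℤ) = p + i + l * d :=
  Label.ofInt_eq hd _

lemma Label.shift_zero (hd : Odd d) (p : Label d) : Label.shift hd 0 p = p := by
  change Label.ofInt hd _ = p
  rw [add_zero, Label.ofInt_coe]

lemma sum_label_add {M : Type*} [AddCommMonoid M] (hd : Odd d) (f : ℤ → M)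
    (hf : ∀ m l : ℤ, f (m + l * d) = f m) (c : ℤ) :
    ∑ p : Label d, f (p + c) = ∑ p : Label d, f p := by
  rw [← (Label.shift hd c).sum_comp fun p => f p]
  refine Finset.sum_congr rfl fun p _ => ?_
  obtain ⟨l, hl⟩ := Label.shift_eq hd c p
  rw [hl, hf]

lemma Label.card (hd : Odd d) : Fintype.card (Label d) = d := by
  obtain ⟨k, rfl⟩ := hd
  rw [Fintype.card_coe, Int.card_Icc]
  push_cast
  omega

/-- Every integer is uniquely a label plus a multiple of `d`. -/
def labelEquiv (hd : Odd d) : Label d × ℤ ≃ ℤ where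
  toFun x := x.1 + x.2 * d
  invFun m := (Label.ofInt hd m, Int.bdiv m d)
  left_inv := by
    rintro ⟨p, l⟩
    have h1 : Label.ofInt hd (p + l * d) = p := by
      rw [Label.ofInt_eq_iff]; exact ⟨l, by ring⟩
    have h2 : Int.bmod (p + l * d) d = p := congrArg Subtype.val h1
    have h3 := Int.bmod_add_bdiv' (p + l * d) d
    have hd0 : (d : ℤ) ≠ 0 := by exact_mod_cast hd.pos.ne'
    rw [h2] at h3
    exact Prod.ext h1 (mul_right_cancel₀ hd0 (by linarith))
  right_inv m := Int.bmod_add_bdiv' m d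

lemma sum_label_tsum (hd : Odd d) {f : ℤ → ℝ} (hf : Summable f) :
    ∑ p : Label d, ∑' l : ℤ, f (p + l * d) = ∑' m : ℤ, f m := by
  have h : Summable fun x : Label d × ℤ => f (x.1 + x.2 * d) :=
    (labelEquiv hd).summable_iff.mpr hf
  rw [← (labelEquiv hd).tsum_eq, ← tsum_fintype (L := .unconditional _)]
  exact (h.tsum_prod).symm

lemma cis_div_eq_one_iff (hd : Odd d) (j : ℤ) : cis ((j : ℝ) / d) = 1 ↔ (d : ℤ) ∣ j := by
  have hd0 : (d : ℝ) ≠ 0 := by exact_mod_cast hd.pos.ne'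
  rw [cis_eq_one_iff]
  refine exists_congr fun n => ?_
  rw [div_eq_iff hd0]
  constructor
  · intro h; rw [mul_comm]; exact_mod_cast h
  · intro h; rw [h]; push_cast; ring

lemma sum_label_cis (hd : Odd d) (j : ℤ) :
    ∑ k : Label d, cis (((k : ℤ) : ℝ) * j / d) = if (d : ℤ) ∣ j then (d : ℂ) else 0 := by
  have hd0 : (d : ℝ) ≠ 0 := by exact_mod_cast hd.pos.ne'
  split_ifs with h
  · have : ∀ k : Label d, cis (((k : ℤ) : ℝ) * j / d) = 1 := fun k => by
      have := (cis_div_eq_one_iff hd (k * j)).mpr (h.mul_left _)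
      push_cast at this
      exact this
    rw [Finset.sum_congr rfl fun k _ => this k, Finset.sum_const, Finset.card_univ, Label.card hd]
    simp
  -- Shifting the labels by one multiplies the sum by a root of unity different from 1, so the sum
  -- vanishes.
  · have h1 := sum_label_add hd (fun m : ℤ => cis ((m : ℝ) * j / d)) (fun m l => by
      rw [show (((m + l * d : ℤ) : ℝ) * j / d) = (m : ℝ) * j / d + ((l * j : ℤ) : ℝ) by
        push_cast; field_simp, cis_add_int]) 1
    have h2 : ∀ k : Label d, cis ((((k : ℤ) + 1 : ℤ) : ℝ) * j / d) =
        cis (((k : ℤ) : ℝ) * j / d) * cis ((j : ℝ) / d) := fun k => by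
      rw [← cis_add]; congr 1; push_cast; ring
    simp only [h2, ← Finset.sum_mul] at h1
    have h3 : cis ((j : ℝ) / d) - 1 ≠ 0 :=
      sub_ne_zero.mpr fun h' => h ((cis_div_eq_one_iff hd j).mp h')
    refine (mul_eq_zero.mp ?_).resolve_right h3
    linear_combination h1

end Label

/-! ### Wrapped Gaussians -/

lemma hasSum_gauss {a : ℝ} (ha : 0 < a) (x : ℝ) :
    HasSum (fun m : ℤ => Real.exp (-(a * (m + x) ^ 2))) (√(π / a) * theta x (π / a)) := by
  have h := hasSum_exp_shift (s := π / a) (by positivity) x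
  rwa [show π / (π / a) = a by field_simp] at h

lemma hasSum_gauss_zero {a : ℝ} (ha : 0 < a) :
    HasSum (fun m : ℤ => Real.exp (-(a * m ^ 2))) (theta 0 (a / π)) := by
  have h := hasSum_theta_zero (s := a / π) (by positivity)
  rwa [show π * (a / π) = a by field_simp] at h

lemma sqrt_mul_theta_zero {a : ℝ} (ha : 0 < a) :
    √(π / a) * theta 0 (π / a) = theta 0 (a / π) := by
  have h := hasSum_gauss ha 0
  simp only [add_zero] at h
  exact h.unique (hasSum_gauss_zero ha)

/-- The Gaussian `x ↦ exp (-a x²)` wrapped around the integers modulo `d`. -/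
def wrapGauss (a : ℝ) (d : ℕ) (q : ℤ) : ℝ := ∑' l : ℤ, Real.exp (-(a * (q + l * d) ^ 2))

lemma wrapGauss_eq {a : ℝ} (ha : 0 < a) {d : ℕ} (hd : 0 < d) (q : ℤ) :
    wrapGauss a d q = √(π / (a * d ^ 2)) * theta (q / d) (π / (a * d ^ 2)) := by
  have hd' : (0 : ℝ) < d := by exact_mod_cast hd
  rw [← (hasSum_gauss (a := a * d ^ 2) (by positivity) (q / d)).tsum_eq]
  refine tsum_congr fun l => ?_
  congr 1
  field_simp
  ring

lemma wrapGauss_pos {a : ℝ} (ha : 0 < a) {d : ℕ} (hd : 0 < d) (q : ℤ) : 0 < wrapGauss a d q := by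
  have hd' : (0 : ℝ) < d := by exact_mod_cast hd
  rw [wrapGauss_eq ha hd]
  exact mul_pos (Real.sqrt_pos.mpr (by positivity)) (theta_pos (by positivity) _)

/-- Completing the square: the exponential tilt moves the centre of the Gaussian to c + r/(2a). -/
lemma hasSum_gauss_mul_exp {a : ℝ} (ha : 0 < a) (c : ℤ) (x r : ℝ) :
    HasSum (fun m : ℤ => Real.exp (-(a * ((m - c : ℤ) : ℝ) ^ 2)) * Real.exp (r * (m + x)))
      (Real.exp (r ^ 2 / (4 * a)) * Real.exp (r * (c + x)) *
        (√(π / a) * theta (-c - r / (2 * a)) (π / a))) := by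
  refine ((hasSum_gauss ha (-c - r / (2 * a))).mul_left _).congr_fun fun m => ?_
  rw [← Real.exp_add, ← Real.exp_add, ← Real.exp_add]
  congr 1
  push_cast
  field_simp
  ring

lemma tsum_gauss_mul_exp_le {a : ℝ} (ha : 0 < a) (c : ℤ) (x r : ℝ) :
    ∑' m : ℤ, Real.exp (-(a * ((m - c : ℤ) : ℝ) ^ 2)) * Real.exp (r * (m + x)) ≤
      Real.exp (r ^ 2 / (4 * a)) * Real.exp (r * (c + x)) * theta 0 (a / π) := by
  rw [(hasSum_gauss_mul_exp ha c x r).tsum_eq, ← sqrt_mul_theta_zero ha]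
  have := theta_le_theta_zero (s := π / a) (by positivity) (-c - r / (2 * a))
  gcongr

lemma exp_add_exp_neg_le {r x y : ℝ} (h : |x| ≤ |y|) :
    Real.exp (r * x) + Real.exp (-r * x) ≤ Real.exp (r * y) + Real.exp (-r * y) := by
  have h1 : Real.cosh (r * x) ≤ Real.cosh (r * y) := by
    rw [Real.cosh_le_cosh, abs_mul, abs_mul]; gcongr
  rw [Real.cosh_eq, Real.cosh_eq] at h1
  rw [neg_mul, neg_mul]
  linarith

/-- A label is the representative of its class closest to 0. As d is odd, there is room for a shift
up to 1/2; the shift x = 1/2 is the one that places the top label at d/2. -/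
lemma Label.abs_le_abs {d : ℕ} (hd : Odd d) (q : Label d) (l : ℤ) {x : ℝ} (hx : |2 * x| ≤ 1) :
    |((q : ℤ) : ℝ) + x| ≤ |(((q : ℤ) + l * d : ℤ) : ℝ) + x| := by
  have hq := q.bounds hd
  have h1 : -((d : ℝ) - 1) ≤ 2 * ((q : ℤ) : ℝ) := by
    have : -((d : ℤ) - 1) ≤ 2 * (q : ℤ) := by omega
    exact_mod_cast this
  have h2 : 2 * ((q : ℤ) : ℝ) ≤ (d : ℝ) - 1 := by
    have : 2 * (q : ℤ) ≤ (d : ℤ) - 1 := by omega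
    exact_mod_cast this
  have h3 := abs_le.mp hx
  have hd0 : (0 : ℝ) ≤ d := by positivity
  push_cast
  rcases lt_trichotomy l 0 with hl | rfl | hl
  · have hl' : (l : ℝ) ≤ -1 := by exact_mod_cast (by omega : l ≤ -1)
    have h5 : (l : ℝ) * d ≤ -1 * d := by gcongr
    exact abs_le.mpr ⟨by linarith [neg_le_abs ((q : ℤ) + l * d + x : ℝ)],
      by linarith [neg_le_abs ((q : ℤ) + l * d + x : ℝ)]⟩
  · simp
  · have hl' : (1 : ℝ) ≤ l := by exact_mod_cast hl
    have h5 : (1 : ℝ) * d ≤ l * d := by gcongr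
    exact abs_le.mpr ⟨by linarith [le_abs_self ((q : ℤ) + l * d + x : ℝ)],
      by linarith [le_abs_self ((q : ℤ) + l * d + x : ℝ)]⟩

lemma summable_wrap {a : ℝ} (ha : 0 < a) {d : ℕ} (hd : 0 < d) (q : ℤ) :
    Summable fun l : ℤ => Real.exp (-(a * (q + l * d) ^ 2)) := by
  have hd' : (0 : ℝ) < d := by exact_mod_cast hd
  refine ((hasSum_gauss (a := a * d ^ 2) (by positivity) (q / d)).summable).congr fun l => ?_
  congr 1
  field_simp
  ring

/-- The exponential moments of a wrapped Gaussian are dominated by those of the Gaussian. -/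
lemma sum_wrapGauss_mul_exp_le {a : ℝ} (ha : 0 < a) {d : ℕ} (hd : Odd d) (c : ℤ) {x : ℝ}
    (hx : |2 * x| ≤ 1) (r : ℝ) :
    ∑ q : Label d, wrapGauss a d (q - c) *
        (Real.exp (r * ((q : ℤ) + x)) + Real.exp (-r * ((q : ℤ) + x))) ≤
      Real.exp (r ^ 2 / (4 * a)) * (Real.exp (r * (c + x)) + Real.exp (-r * (c + x))) *
        theta 0 (a / π) := by
  set f : ℤ → ℝ := fun m => Real.exp (-(a * ((m - c : ℤ) : ℝ) ^ 2)) * Real.exp (r * (m + x)) +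
    Real.exp (-(a * ((m - c : ℤ) : ℝ) ^ 2)) * Real.exp (-r * (m + x)) with hf
  have s1 := (hasSum_gauss_mul_exp ha c x r).summable
  have s2 := (hasSum_gauss_mul_exp ha c x (-r)).summable
  have sf : Summable f := s1.add s2
  have hd0 : (d : ℤ) ≠ 0 := by exact_mod_cast hd.pos.ne'
  calc _ ≤ ∑ q : Label d, ∑' l : ℤ, f (q + l * d) := by
        refine Finset.sum_le_sum fun q _ => ?_
        have hinj : Function.Injective fun l : ℤ => (q : ℤ) + l * d := fun l k h =>
          mul_right_cancel₀ hd0 (add_left_cancel h)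
        rw [wrapGauss, ← tsum_mul_right]
        refine Summable.tsum_le_tsum (fun l => ?_) ?_ (sf.comp_injective hinj)
        -- The hyperbolic cosine increases with the absolute value, so replacing the label by any
        -- other representative of its class can only increase the sum. This undoes the wrapping.
        · have := exp_add_exp_neg_le (r := r) (Label.abs_le_abs hd q l hx)
          rw [hf]
          simp only [← mul_add]
          rw [show (((q : ℤ) + l * d - c : ℤ) : ℝ) = ((q - c : ℤ) : ℝ) + l * d by push_cast; ring]
          gcongr
        · exact (summable_wrap ha hd.pos _).mul_right _
    _ = ∑' m : ℤ, f m := sum_label_tsum hd sf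
    _ ≤ _ := by
        rw [hf, s1.tsum_add s2]
        have h1 := tsum_gauss_mul_exp_le ha c x r
        have h2 := tsum_gauss_mul_exp_le ha c x (-r)
        rw [neg_sq] at h2
        linarith

/-! ### Sums of products of theta functions over the labels -/

lemma hasSum_mul_int {f g : ℤ → ℂ} {a b : ℂ} (hf : HasSum f a) (hg : HasSum g b) :
    HasSum (fun m : ℤ × ℤ => f m.1 * g m.2) (a * b) :=
  hf.mul hg (summable_mul_of_summable_norm hf.summable.norm hg.summable.norm)

lemma hasSum_theta_mul {s u : ℝ} (hs : 0 < s) (hu : 0 < u) (x y : ℝ) :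
    HasSum (fun m : ℤ × ℤ => (((Real.exp (-(π * s * m.1 ^ 2)) : ℝ) : ℂ) * cis (m.1 * x)) *
      (((Real.exp (-(π * u * m.2 ^ 2)) : ℝ) : ℂ) * cis (m.2 * y)))
      (theta x s * theta y u : ℂ) :=
  by
  have h := hasSum_mul_int (hasSum_theta hs x) (hasSum_theta hu y)
  exact h

lemma one_add_cis_half (n : ℤ) : 1 + cis ((n : ℝ) / 2) = if (2 : ℤ) ∣ n then 2 else 0 := by
  split_ifs with h
  · obtain ⟨k, rfl⟩ := h
    rw [show ((2 * k : ℤ) : ℝ) / 2 = (k : ℝ) by push_cast; ring, cis_int]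
    norm_num
  · obtain ⟨k, rfl⟩ : Odd n := Int.not_even_iff_odd.mp fun h' => h h'.two_dvd
    rw [show ((2 * k + 1 : ℤ) : ℝ) / 2 = 1 / 2 + (k : ℝ) by push_cast; ring, cis_add_int, cis_half]
    norm_num

/-- Summing over the ring keeps the pairs of frequencies (dl - m, m). With b = dl - 2m one has (dl -
m)² + m² = (d²l² + b²)/2, which separates the variables. As d is odd, the condition on (l, b) is
that l + b be even, and it is imposed by adding the products at arguments translated by 1/2. -/
lemma sum_theta_mul_theta {d : ℕ} (hd : Odd d) {s : ℝ} (hs : 0 < s) (w : ℝ) :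
    ∑ p : Label d, theta (((p : ℤ) : ℝ) / d) s * theta (((p : ℤ) : ℝ) / d + w) s =
      d / 2 * (theta (d * w / 2) (d ^ 2 * s / 2) * theta (w / 2) (s / 2) +
        theta (d * w / 2 + 1 / 2) (d ^ 2 * s / 2) * theta (1 / 2 - w / 2) (s / 2)) := by
  have hd' : (0 : ℝ) < d := by exact_mod_cast hd.pos
  have hd0 : (d : ℤ) ≠ 0 := by exact_mod_cast hd.pos.ne'
  have h1 := hasSum_sum (s := Finset.univ) fun (p : Label d) _ =>
    hasSum_theta_mul hs hs (((p : ℤ) : ℝ) / d) (((p : ℤ) : ℝ) / d + w)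
  set F : ℤ × ℤ → ℂ := fun x =>
    ((Real.exp (-(π * s * (d * x.1 - x.2) ^ 2)) * Real.exp (-(π * s * x.2 ^ 2)) : ℝ) : ℂ) *
      cis (x.2 * w) with hF
  have e1 : ∀ m : ℤ × ℤ, (∑ p : Label d,
      (((Real.exp (-(π * s * m.1 ^ 2)) : ℝ) : ℂ) * cis (m.1 * (((p : ℤ) : ℝ) / d))) *
      (((Real.exp (-(π * s * m.2 ^ 2)) : ℝ) : ℂ) * cis (m.2 * (((p : ℤ) : ℝ) / d + w)))) =
      ((Real.exp (-(π * s * m.1 ^ 2)) * Real.exp (-(π * s * m.2 ^ 2)) : ℝ) : ℂ) *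
        cis (m.2 * w) * if (d : ℤ) ∣ m.1 + m.2 then (d : ℂ) else 0 := fun m => by
    rw [← sum_label_cis hd, Finset.mul_sum]
    refine Finset.sum_congr rfl fun p _ => ?_
    rw [show ((p : ℤ) : ℝ) * ((m.1 + m.2 : ℤ) : ℝ) / d =
      m.1 * (((p : ℤ) : ℝ) / d) + m.2 * (((p : ℤ) : ℝ) / d) by push_cast; ring,
      mul_add (m.2 : ℝ), cis_add, cis_add]
    push_cast
    ring
  have i1 : Function.Injective fun x : ℤ × ℤ => ((d : ℤ) * x.1 - x.2, x.2) := by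
    rintro ⟨l, m⟩ ⟨l', m'⟩ h
    simp only [Prod.mk.injEq] at h
    obtain ⟨h, rfl⟩ := h
    have := mul_left_cancel₀ hd0 (sub_left_injective h)
    rw [this]
  have h1' : HasSum (fun x => (d : ℂ) * F x)
      (∑ p : Label d, (theta (((p : ℤ) : ℝ) / d) s * theta (((p : ℤ) : ℝ) / d + w) s : ℂ)) := by
    simp only [e1] at h1
    rw [← i1.hasSum_iff] at h1
    · refine h1.congr_fun fun x => ?_
      simp only [Function.comp, hF]
      rw [if_pos ⟨x.1, by ring⟩]
      push_cast
      ring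
    · rintro ⟨m, m'⟩ hm
      rw [if_neg, mul_zero]
      rintro ⟨l, hl⟩
      exact hm ⟨(l, m'), by simp only at hl ⊢; rw [← hl]; simp⟩
  have h2 := (hasSum_theta_mul (s := d ^ 2 * s / 2) (u := s / 2) (by positivity) (by positivity)
    (d * w / 2) (-(w / 2))).add (hasSum_theta_mul (s := d ^ 2 * s / 2) (u := s / 2) (by positivity)
      (by positivity) (d * w / 2 + 1 / 2) (-(w / 2) + 1 / 2))
  have i2 : Function.Injective fun x : ℤ × ℤ => (x.1, (d : ℤ) * x.1 - 2 * x.2) := by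
    rintro ⟨l, m⟩ ⟨l', m'⟩ h
    simp only [Prod.mk.injEq] at h
    obtain ⟨rfl, h⟩ := h
    rw [Prod.mk.injEq]
    exact ⟨rfl, by omega⟩
  have e2 : ∀ m : ℤ × ℤ,
      (((Real.exp (-(π * (d ^ 2 * s / 2) * m.1 ^ 2)) : ℝ) : ℂ) * cis (m.1 * (d * w / 2))) *
      (((Real.exp (-(π * (s / 2) * m.2 ^ 2)) : ℝ) : ℂ) * cis (m.2 * (-(w / 2)))) +
      (((Real.exp (-(π * (d ^ 2 * s / 2) * m.1 ^ 2)) : ℝ) : ℂ) *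
        cis (m.1 * (d * w / 2 + 1 / 2))) *
      (((Real.exp (-(π * (s / 2) * m.2 ^ 2)) : ℝ) : ℂ) * cis (m.2 * (-(w / 2) + 1 / 2))) =
      ((Real.exp (-(π * (d ^ 2 * s / 2) * m.1 ^ 2)) * Real.exp (-(π * (s / 2) * m.2 ^ 2)) : ℝ) : ℂ)
        * cis ((d * m.1 - m.2) / 2 * w) * if (2 : ℤ) ∣ m.1 + m.2 then 2 else 0 := fun m => by
    rw [← one_add_cis_half, show (d * m.1 - m.2) / 2 * w = m.1 * (d * w / 2) + m.2 * (-(w / 2)) by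
      ring, show ((m.1 + m.2 : ℤ) : ℝ) / 2 = m.1 * (1 / 2) + m.2 * (1 / 2) by push_cast; ring,
      mul_add (m.1 : ℝ), mul_add (m.2 : ℝ), cis_add, cis_add, cis_add, cis_add]
    push_cast
    ring
  have h2' : HasSum (fun x => 2 * F x)
      ((theta (d * w / 2) (d ^ 2 * s / 2) * theta (-(w / 2)) (s / 2) : ℂ) +
        (theta (d * w / 2 + 1 / 2) (d ^ 2 * s / 2) * theta (-(w / 2) + 1 / 2) (s / 2) : ℂ)) := by
    simp only [e2] at h2
    rw [← i2.hasSum_iff] at h2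
    · refine h2.congr_fun fun x => ?_
      obtain ⟨k, hk⟩ := hd
      simp only [Function.comp, hF]
      rw [if_pos ⟨(k + 1) * x.1 - x.2, by rw [hk]; push_cast; ring⟩, ← Real.exp_add,
        ← Real.exp_add]
      push_cast
      rw [show ((d : ℝ) * x.1 - (d * x.1 - 2 * x.2)) / 2 * w = x.2 * w by ring]
      ring_nf
    · rintro ⟨l, b⟩ hm
      rw [if_neg, mul_zero]
      rintro ⟨c, hc⟩
      obtain ⟨k, hk⟩ := hd
      refine hm ⟨(l, (k + 1) * l - c), ?_⟩
      simp only at hc ⊢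
      rw [Prod.mk.injEq]
      refine ⟨rfl, ?_⟩
      rw [hk]
      push_cast
      linear_combination -hc
  have h3 := h1'.unique ((h2'.mul_left ((d : ℂ) / 2)).congr_fun fun x => by ring)
  rw [show (1 : ℝ) / 2 - w / 2 = -(w / 2) + 1 / 2 by ring, ← theta_neg (w / 2)]
  apply Complex.ofReal_injective
  push_cast
  rw [h3]

/-- Gauss' duplication formulas. -/
lemma theta_dual {b : ℝ} (hb : 0 < b) :
    theta 0 (1 / (4 * b)) = √b * (theta 0 b + theta (1 / 2) b) ∧
      theta (1 / 2) (1 / (4 * b)) = √b * (theta 0 b - theta (1 / 2) b) := by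
  have h0 := hasSum_theta hb 0
  have h1 := hasSum_theta hb (1 / 2)
  have key : ∀ x : ℝ, HasSum (fun l : ℤ => Real.exp (-(π * b * (2 * (l + x)) ^ 2)))
      (√(1 / (4 * b)) * theta x (1 / (4 * b))) := fun x => by
    refine (hasSum_exp_shift (s := 1 / (4 * b)) (by positivity) x).congr_fun fun l => ?_
    congr 1
    field_simp
    ring
  have hsq : √b * √(1 / (4 * b)) = 1 / 2 := by
    rw [← Real.sqrt_mul hb.le, show b * (1 / (4 * b)) = (1 / 2) ^ 2 by field_simp; norm_num,
      Real.sqrt_sq (by norm_num)]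
  have i0 : Function.Injective fun l : ℤ => 2 * l := fun a b h => by simpa using h
  have i1 : Function.Injective fun l : ℤ => 2 * l + 1 := fun a b h => by simpa using h
  have e : ∀ m : ℤ, cis ((m : ℝ) * (1 / 2)) = (if (2 : ℤ) ∣ m then 2 else 0) - 1 := fun m => by
    rw [← one_add_cis_half, mul_one_div]; ring
  -- The sum of the two series retains twice the even frequencies, their difference twice the odd
  -- ones; both are Gaussian sums of step 2, dual to θ₃ at 1/(4b).
  have a0 : (theta 0 b + theta (1 / 2) b) = 2 * (√(1 / (4 * b)) * theta 0 (1 / (4 * b))) := by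
    have h := h0.add h1
    rw [← i0.hasSum_iff] at h
    · have h' := h.unique ((Complex.hasSum_ofReal.mpr ((key 0).mul_left 2)).congr_fun fun l => by
        simp only [Function.comp, mul_zero, cis_zero, e]
        rw [if_pos ⟨l, rfl⟩]
        push_cast
        ring_nf)
      exact_mod_cast h'
    · intro m hm
      rw [e, mul_zero, cis_zero, if_neg]
      · ring
      · rintro ⟨k, rfl⟩; exact hm ⟨k, rfl⟩
  have a1 : (theta 0 b - theta (1 / 2) b) =
      2 * (√(1 / (4 * b)) * theta (1 / 2) (1 / (4 * b))) := by
    have h := h0.sub h1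
    rw [← i1.hasSum_iff] at h
    · have h' := h.unique ((Complex.hasSum_ofReal.mpr ((key (1 / 2)).mul_left 2)).congr_fun
        fun l => by
          simp only [Function.comp, mul_zero, cis_zero, e]
          rw [if_neg (by omega)]
          push_cast
          ring_nf)
      exact_mod_cast h'
    · intro m hm
      rw [e, mul_zero, cis_zero, if_pos]
      · ring
      · by_contra h
        obtain ⟨k, rfl⟩ : Odd m := Int.not_even_iff_odd.mp fun h' => h h'.two_dvd
        exact hm ⟨k, rfl⟩
  constructor
  · rw [a0]; linear_combination (-2 * theta 0 (1 / (4 * b))) * hsq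
  · rw [a1]; linear_combination (-2 * theta (1 / 2) (1 / (4 * b))) * hsq

/-! ### Fourier series on an interval -/

lemma setIntegral_cis {L : ℝ} (hL : 0 < L) (n : ℤ) :
    ∫ x in Set.Icc (-(L / 2)) (L / 2), cis (n * (x / L)) = if n = 0 then (L : ℂ) else 0 := by
  rw [integral_Icc_eq_integral_Ioc, ← intervalIntegral.integral_of_le (by linarith)]
  split_ifs with h
  · simp [h, cis_zero]
  · have hLc : (L : ℂ) ≠ 0 := by exact_mod_cast hL.ne'
    have hn : (n : ℂ) ≠ 0 := by exact_mod_cast h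
    have hc : (2 * π * I * n / L : ℂ) ≠ 0 :=
      div_ne_zero (mul_ne_zero Complex.two_pi_I_ne_zero hn) hLc
    have e : ∀ x : ℝ, cis (n * (x / L)) = Complex.exp ((2 * π * I * n / L : ℂ) * x) := fun x => by
      rw [cis]; congr 1; push_cast; ring
    simp only [e]
    rw [integral_exp_mul_complex hc, ← e, ← e]
    have : (n : ℝ) * (L / 2 / L) = n * (-(L / 2) / L) + n := by field_simp; ring
    rw [this, cis_add_int, sub_self, zero_div]

/-- Absolute convergence of the coefficients allows termwise integration of the double series;
orthogonality retains only the pairs (m, m - j). -/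
lemma hasSum_setIntegral_fourier {L : ℝ} (hL : 0 < L) {A B : ℤ → ℂ} (hA : Summable A)
    (hB : Summable B) {f h : ℝ → ℂ} (hf : ∀ x, HasSum (fun m => A m * cis (-(m * (x / L)))) (f x))
    (hh : ∀ x, HasSum (fun m => B m * cis (-(m * (x / L)))) (h x)) (j : ℤ) :
    HasSum (fun m => L * (conj (A m) * B (m - j)))
      (∫ x in Set.Icc (-(L / 2)) (L / 2), conj (f x) * h x * cis (-(j * (x / L)))) := by
  have key : ∀ x, HasSum (fun m : ℤ × ℤ => conj (A m.1) * B m.2 *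
      cis (((m.1 - m.2 - j : ℤ) : ℝ) * (x / L))) (conj (f x) * h x * cis (-(j * (x / L)))) := by
    intro x
    have h1 := (hasSum_mul_int ((hf x).map (starRingEnd ℂ) Complex.continuous_conj) (hh x)).mul_right
      (cis (-(j * (x / L))))
    refine h1.congr_fun fun m => ?_
    simp only [Function.comp, map_mul, ← cis_neg, neg_neg]
    rw [show ((m.1 - m.2 - j : ℤ) : ℝ) * (x / L) =
      m.1 * (x / L) + -(m.2 * (x / L)) + -(j * (x / L)) by push_cast; ring, cis_add, cis_add]
    ring
  have hs : Summable fun m : ℤ × ℤ => ‖conj (A m.1) * B m.2‖ := by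
    have h1 := summable_mul_of_summable_norm (f := fun m => conj (A m)) (g := B)
      (by simpa using hA.norm) hB.norm
    exact h1.norm
  have h2 := hasSum_integral_of_summable_integral_norm
    (μ := volume.restrict (Set.Icc (-(L / 2)) (L / 2)))
    (F := fun (m : ℤ × ℤ) x => conj (A m.1) * B m.2 * cis (((m.1 - m.2 - j : ℤ) : ℝ) * (x / L)))
    (fun m => by
      have : Continuous fun x : ℝ => conj (A m.1) * B m.2 *
          cis (((m.1 - m.2 - j : ℤ) : ℝ) * (x / L)) :=
        continuous_const.mul (continuous_cis.comp (by fun_prop))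
      exact this.integrableOn_Icc)
    (by
      simp only [norm_mul _ (cis _), norm_cis, mul_one, integral_const]
      exact hs.const_smul _)
  simp only [(key _).tsum_eq, integral_const_mul, setIntegral_cis hL] at h2
  have i1 : Function.Injective fun m : ℤ => (m, m - j) := fun a b hab => congrArg Prod.fst hab
  rw [← i1.hasSum_iff] at h2
  · refine h2.congr_fun fun m => ?_
    simp only [Function.comp]
    rw [if_pos (by ring)]
    ring
  · rintro ⟨m, m'⟩ hm
    rw [if_neg, mul_zero]
    intro h0
    exact hm ⟨m, by simp only [Prod.mk.injEq, true_and]; simp only at h0; omega⟩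

/-! ### The Kraus operators -/

section Kraus

variable {d : ℕ}

/-- The normalization constant of the Kraus operators. -/
def krausNorm (d : ℕ) (σsq : ℝ) : ℝ :=
  1 / Real.sqrt (theta 0 (2 * σsq / d)) * (1 / (d : ℝ) ^ (1 / 4 : ℝ))

lemma sqrt_mul_krausNorm_sq (hd : Odd d) {σsq : ℝ} (hσ : 0 < σsq) :
    √d * krausNorm d σsq ^ 2 = 1 / theta 0 (2 * σsq / d) := by
  have hd' : (0 : ℝ) < d := by exact_mod_cast hd.pos
  have h1 : ((d : ℝ) ^ (1 / 4 : ℝ)) ^ 2 = √d := by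
    rw [← Real.rpow_natCast, ← Real.rpow_mul hd'.le, Real.sqrt_eq_rpow]; norm_num
  have h2 := theta_pos (s := 2 * σsq / d) (by positivity) 0
  have h3 : √(d : ℝ) ≠ 0 := (Real.sqrt_pos.mpr hd').ne'
  rw [krausNorm, mul_pow, div_pow, div_pow, h1, Real.sq_sqrt h2.le]
  field_simp

lemma timeState_mul_conj (hd : Odd d) (k n n' : Label d) :
    timeState d k n * conj (timeState d k n') =
      1 / d * cis (((k : ℤ) : ℝ) * (((n' : ℤ) - n : ℤ) : ℝ) / d) := by
  have hd' : (0 : ℝ) < d := by exact_mod_cast hd.pos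
  have e : ∀ m : Label d, timeState d k m =
      ((1 / Real.sqrt d : ℝ) : ℂ) * cis (-(((k : ℤ) : ℝ) * ((m : ℤ) : ℝ) / d)) := fun m => by
    rw [timeState, cis]; congr 2; push_cast; ring
  have h1 : ((1 / Real.sqrt d : ℝ) : ℂ) * ((1 / Real.sqrt d : ℝ) : ℂ) = 1 / d := by
    rw [← Complex.ofReal_mul, div_mul_div_comm, Real.mul_self_sqrt hd'.le]; push_cast; ring
  rw [e, e, map_mul, Complex.conj_ofReal, ← cis_neg, neg_neg, mul_mul_mul_comm, h1, ← cis_add]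
  congr 2
  push_cast
  ring

/-- The Fourier coefficients of the entries of the Kraus operators. -/
def krausFourier (d : ℕ) (σsq : ℝ) (q m : ℤ) : ℂ :=
  if (d : ℤ) ∣ m - q then ((krausNorm d σsq * Real.exp (-(π * (σsq / d) * m ^ 2)) : ℝ) : ℂ) else 0

/-- The sum over the time labels k is a character sum, and it selects the frequencies m congruent to
n - n'. -/
lemma hasSum_kraus (hd : Odd d) {σsq : ℝ} (hσ : 0 < σsq) (x : ℝ) (n n' : Label d) :
    HasSum (fun m : ℤ => krausFourier d σsq ((n : ℤ) - n') m * cis (-(m * (x / √d))))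
      (kraus d σsq x n n') := by
  have hd' : (0 : ℝ) < d := by exact_mod_cast hd.pos
  have hsq : √(d : ℝ) ≠ 0 := (Real.sqrt_pos.mpr hd').ne'
  have h := hasSum_sum (s := Finset.univ) fun (k : Label d) _ =>
    (hasSum_theta (s := σsq / d) (by positivity) ((((k : ℤ) : ℝ) - x * √d) / d)).mul_left
      ((krausNorm d σsq : ℂ) * (timeState d k n * conj (timeState d k n')))
  have h2 : ∑ k : Label d, (krausNorm d σsq : ℂ) * (timeState d k n * conj (timeState d k n')) *
      (theta ((((k : ℤ) : ℝ) - x * √d) / d) (σsq / d) : ℂ) = kraus d σsq x n n' := by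
    rw [kraus, Matrix.sum_apply]
    refine Finset.sum_congr rfl fun k _ => ?_
    rw [Matrix.smul_apply, Matrix.vecMulVec_apply, smul_eq_mul, krausCoeff, Pi.star_apply,
      ← krausNorm]
    push_cast
    rw [Complex.star_def]
    ring
  rw [h2] at h
  refine h.congr_fun fun m => ?_
  have h3 : ∀ k : Label d, (krausNorm d σsq : ℂ) * (timeState d k n * conj (timeState d k n')) *
      (((Real.exp (-(π * (σsq / d) * m ^ 2)) : ℝ) : ℂ) *
        cis (m * ((((k : ℤ) : ℝ) - x * √d) / d))) =
      ((krausNorm d σsq * Real.exp (-(π * (σsq / d) * m ^ 2)) : ℝ) : ℂ) * cis (-(m * (x / √d))) *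
        (1 / d * cis (((k : ℤ) : ℝ) * ((m - (n - n') : ℤ) : ℝ) / d)) := fun k => by
    rw [timeState_mul_conj hd, show (m : ℝ) * ((((k : ℤ) : ℝ) - x * √d) / d) =
      -(m * (x / √d)) + ((k : ℤ) : ℝ) * m / d by
        rw [sub_div, mul_div_assoc x, Real.sqrt_div_self', mul_one_div]
        ring,
      show ((k : ℤ) : ℝ) * ((m - (n - n') : ℤ) : ℝ) / d =
        ((k : ℤ) : ℝ) * m / d + ((k : ℤ) : ℝ) * (((n' : ℤ) - n : ℤ) : ℝ) / d by push_cast; ring,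
      cis_add, cis_add]
    push_cast
    ring
  simp only [h3]
  rw [← Finset.mul_sum, ← Finset.mul_sum, sum_label_cis hd, krausFourier]
  have hdc : (d : ℂ) ≠ 0 := by exact_mod_cast hd'.ne'
  split_ifs
  · field_simp
  · simp

lemma summable_krausFourier (hd : Odd d) {σsq : ℝ} (hσ : 0 < σsq) (q : ℤ) :
    Summable (krausFourier d σsq q) := by
  have hd' : (0 : ℝ) < d := by exact_mod_cast hd.pos
  refine Summable.of_norm_bounded
    ((summable_exp_sq (s := σsq / d) (by positivity)).mul_left |krausNorm d σsq|) fun m => ?_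
  rw [krausFourier]
  split_ifs
  · rw [Complex.norm_real, norm_mul, Real.norm_eq_abs, Real.norm_of_nonneg (Real.exp_pos _).le]
  · rw [norm_zero]; positivity

/-- The summand of the correlations of the Kraus operators. -/
def krausProd (d : ℕ) (σsq : ℝ) (j m : ℤ) : ℝ :=
  Real.exp (-(π * (σsq / d) * m ^ 2)) * Real.exp (-(π * (σsq / d) * ((m - j : ℤ) : ℝ) ^ 2)) /
    theta 0 (2 * σsq / d)

/-- The correlations of the Kraus operators. -/
def krausCorr (d : ℕ) (σsq : ℝ) (j q : ℤ) : ℝ := ∑' l : ℤ, krausProd d σsq j (q + l * d)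

lemma setIntegral_kraus (hd : Odd d) {σsq : ℝ} (hσ : 0 < σsq) (i j : ℤ) (p n n' : Label d) :
    ∫ x in Set.Icc (-(√d / 2)) (√d / 2), conj (kraus d σsq x p n) *
        kraus d σsq x (Label.shift hd i p) n' * cis (-(j * (x / √d))) =
      if n' = Label.shift hd (i + j) n then (krausCorr d σsq j ((p : ℤ) - n) : ℂ) else 0 := by
  have hd' : (0 : ℝ) < d := by exact_mod_cast hd.pos
  have hd0 : (d : ℤ) ≠ 0 := by exact_mod_cast hd.pos.ne'
  have hsq : 0 < √(d : ℝ) := Real.sqrt_pos.mpr hd'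
  have h := hasSum_setIntegral_fourier hsq (summable_krausFourier hd hσ _)
    (summable_krausFourier hd hσ _) (fun x => hasSum_kraus hd hσ x p n)
    (fun x => hasSum_kraus hd hσ x (Label.shift hd i p) n') j
  obtain ⟨l, hl⟩ := Label.shift_eq hd i p
  -- Once m ≡ p - n, survival of the second coefficient depends on n' alone, not on m. Hence either
  -- the whole class contributes or nothing does.
  have e : ∀ m : ℤ, (d : ℤ) ∣ m - (p - n) →
      ((d : ℤ) ∣ m - j - ((Label.shift hd i p : Label d) - n') ↔
        n' = Label.shift hd (i + j) n) := by
    rintro m ⟨k, hk⟩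
    rw [eq_comm]
    change _ ↔ Label.ofInt hd (n + (i + j)) = n'
    rw [Label.ofInt_eq_iff, hl, show m - j - ((p : ℤ) + i + l * d - n') =
      -((n : ℤ) + (i + j) - n') + (m - (p - n)) - l * d + 2 * ((n' : ℤ) - n') by ring, hk]
    constructor
    · rintro ⟨a, ha⟩; exact ⟨-a + k - l, by linear_combination -ha⟩
    · rintro ⟨a, ha⟩; exact ⟨-a + k - l, by linear_combination -ha⟩
  split_ifs with hn
  · have inj : Function.Injective fun l : ℤ => ((p : ℤ) - n) + l * d := fun l k h =>
      mul_right_cancel₀ hd0 (add_left_cancel h)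
    rw [← inj.hasSum_iff] at h
    · rw [krausCorr, ← h.tsum_eq, Complex.ofReal_tsum]
      refine tsum_congr fun k => ?_
      have hk : (d : ℤ) ∣ (p : ℤ) - n + k * d - (p - n) := ⟨k, by ring⟩
      simp only [Function.comp, krausFourier]
      rw [if_pos hk, if_pos ((e _ hk).mpr hn), Complex.conj_ofReal, krausProd,
        div_eq_mul_one_div (Real.exp _ * _), ← sqrt_mul_krausNorm_sq hd hσ]
      push_cast
      ring
    · intro m hm
      rw [krausFourier, if_neg, map_zero, zero_mul, mul_zero]
      rintro ⟨k, hk⟩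
      exact hm ⟨k, by simp only; linarith⟩
  · refine h.unique (hasSum_zero.congr_fun fun m => ?_)
    rw [krausFourier, krausFourier]
    by_cases hm : (d : ℤ) ∣ m - (p - n)
    · rw [if_neg fun h' => hn ((e m hm).mp h'), mul_zero, mul_zero]
    · rw [if_neg hm, map_zero, zero_mul, mul_zero]

lemma krausProd_zero (d : ℕ) (σsq : ℝ) (m : ℤ) :
    krausProd d σsq 0 m = Real.exp (-(2 * π * σsq / d * m ^ 2)) / theta 0 (2 * σsq / d) := by
  rw [krausProd, ← Real.exp_add]
  congr 2
  push_cast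
  ring

/-- For j = 0 the two Gaussians merge into one of twice the rate, and Poisson summation identifies
its wrapping with the jump law. -/
lemma krausCorr_zero (hd : Odd d) {σsq : ℝ} (hσ : 0 < σsq) (q : ℤ) :
    krausCorr d σsq 0 q = walkJump d σsq q ∧
      walkJump d σsq q = wrapGauss (2 * π * σsq / d) d q / theta 0 (2 * σsq / d) := by
  have hd' : (0 : ℝ) < d := by exact_mod_cast hd.pos
  have h1 : krausCorr d σsq 0 q = wrapGauss (2 * π * σsq / d) d q / theta 0 (2 * σsq / d) := by
    simp only [krausCorr, krausProd_zero, tsum_div_const, wrapGauss]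
    push_cast
    rfl
  have h2 : walkJump d σsq q = wrapGauss (2 * π * σsq / d) d q / theta 0 (2 * σsq / d) := by
    rw [wrapGauss_eq (by positivity) hd.pos, walkJump,
      show π / (2 * π * σsq / d * (d : ℝ) ^ 2) = 1 / (2 * σsq * d) by field_simp,
      Real.sqrt_div zero_le_one, Real.sqrt_one]
    ring
  exact ⟨h1.trans h2.symm, h2⟩

lemma summable_krausProd (hd : Odd d) {σsq : ℝ} (hσ : 0 < σsq) (j : ℤ) :
    Summable (krausProd d σsq j) := by
  have hd' : (0 : ℝ) < d := by exact_mod_cast hd.pos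
  refine Summable.div_const (Summable.of_nonneg_of_le (fun m => by positivity) (fun m => ?_)
    (summable_exp_sq (s := σsq / d) (by positivity))) _
  refine mul_le_of_le_one_right (Real.exp_pos _).le (Real.exp_le_one_iff.mpr ?_)
  rw [neg_nonpos]
  positivity

lemma sum_krausCorr (hd : Odd d) {σsq : ℝ} (hσ : 0 < σsq) (j : ℤ) (n : Label d) :
    ∑ p : Label d, krausCorr d σsq j ((p : ℤ) - n) = ∑' m : ℤ, krausProd d σsq j m := by
  rw [← sum_label_tsum hd (summable_krausProd hd hσ j)]
  have h := sum_label_add hd (krausCorr d σsq j) (fun m l => by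
    unfold krausCorr
    rw [← (Equiv.addLeft l).tsum_eq fun k : ℤ => krausProd d σsq j (m + k * d)]
    refine tsum_congr fun k => ?_
    rw [Equiv.coe_addLeft]
    ring_nf) (-n)
  simp only [← sub_eq_add_neg] at h
  exact h

lemma tsum_krausProd_zero (hd : Odd d) {σsq : ℝ} (hσ : 0 < σsq) :
    ∑' m : ℤ, krausProd d σsq 0 m = 1 := by
  have hd' : (0 : ℝ) < d := by exact_mod_cast hd.pos
  have h := hasSum_gauss_zero (a := 2 * π * σsq / d) (by positivity)
  rw [show 2 * π * σsq / d / π = 2 * σsq / d by field_simp] at h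
  simp only [krausProd_zero, tsum_div_const, h.tsum_eq]
  exact div_self (theta_pos (by positivity) _).ne'

lemma tsum_krausProd_one (hd : Odd d) {σsq : ℝ} (hσ : 0 < σsq) :
    ((∑' m : ℤ, krausProd d σsq 1 m : ℝ) : ℂ) = imprecisionFactor d σsq := by
  have hd' : (0 : ℝ) < d := by exact_mod_cast hd.pos
  have hdc : (d : ℂ) ≠ 0 := by exact_mod_cast hd'.ne'
  have h := hasSum_jacobiTheta₂_term (I * ((σsq / d : ℝ) : ℂ))
    (τ := I * ((2 * σsq / d : ℝ) : ℂ)) (by rw [im_I_mul]; positivity)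
  have h2 := theta_ofReal 0 (2 * σsq / d)
  rw [Complex.ofReal_zero] at h2
  -- Here m² + (m-1)² = 2m² - 2m + 1. The constant gives e^{-πσ²/d}; the linear term gives the
  -- imaginary argument of θ₃ after the reflection m ↦ -m.
  rw [imprecisionFactor, ← h2, div_mul_eq_mul_div, ← h.tsum_eq, ← tsum_mul_right, ← tsum_div_const,
    Complex.ofReal_tsum, ← (Equiv.neg ℤ).tsum_eq]
  refine tsum_congr fun m => ?_
  rw [krausProd, Equiv.neg_apply, ← Real.exp_add, jacobiTheta₂_term, ← Complex.exp_add,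
    Complex.ofReal_div, Complex.ofReal_exp]
  congr 2
  push_cast
  field_simp
  linear_combination (-(2 * (m : ℂ) ^ 2 + 2 * m) * σsq) * Complex.I_sq

lemma continuous_kraus (hd : Odd d) {σsq : ℝ} (hσ : 0 < σsq) : Continuous (kraus d σsq) := by
  have hd' : (0 : ℝ) < d := by exact_mod_cast hd.pos
  have h : ∀ k, Continuous fun x => krausCoeff d σsq x k := fun k => by
    unfold krausCoeff
    exact continuous_const.mul ((continuous_theta (by positivity)).comp (by fun_prop))
  unfold kraus
  exact continuous_finsetSum _ fun k _ =>
    (Complex.continuous_ofReal.comp (h k)).smul continuous_const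

end Kraus

/-! ### Integrating out the outcomes: quadratic forms with a cyclic shift -/

section Moment

variable {d : ℕ}

/-- The expectation of a weighted cyclic shift in the energy eigenbasis. -/
def shiftForm (hd : Odd d) (i : ℤ) (a ψ : Label d → ℂ) : ℂ :=
  ∑ p : Label d, a p * (conj (ψ p) * ψ (Label.shift hd i p))

lemma continuous_shiftForm (hd : Odd d) (i : ℤ) (a : Label d → ℂ) :
    Continuous (shiftForm hd i a) := by
  unfold shiftForm
  refine continuous_finsetSum _ fun p _ => continuous_const.mul
    ((Complex.continuous_conj.comp (continuous_apply p)).mul (continuous_apply _))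

lemma shiftForm_const_mul (hd : Odd d) (i : ℤ) (c : ℂ) (a ψ : Label d → ℂ) :
    shiftForm hd i (fun p => c * a p) ψ = c * shiftForm hd i a ψ := by
  simp only [shiftForm, Finset.mul_sum, mul_assoc]

lemma norm_sq_eq_shiftForm (hd : Odd d) (ψ : Label d → ℂ) :
    ((‖WithLp.toLp 2 ψ‖ ^ 2 : ℝ) : ℂ) = shiftForm hd 0 (fun _ => 1) ψ := by
  rw [EuclideanSpace.norm_sq_eq, shiftForm]
  push_cast
  refine Finset.sum_congr rfl fun p _ => ?_
  rw [Label.shift_zero, one_mul, Complex.conj_mul']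

/-- The Heisenberg picture of one measurement: weighted cyclic shifts are preserved as a class, so
the whole computation reduces to following a shift and a weight. -/
lemma setIntegral_shiftForm_kraus (hd : Odd d) {σsq : ℝ} (hσ : 0 < σsq) (i j : ℤ)
    (a φ : Label d → ℂ) :
    ∫ x in Set.Icc (-(√d / 2)) (√d / 2),
        shiftForm hd i a (kraus d σsq x *ᵥ φ) * cis (-(j * (x / √d))) =
      shiftForm hd (i + j) (fun n => ∑ p : Label d, (krausCorr d σsq j ((p : ℤ) - n) : ℂ) * a p)
        φ := by
  have hK : ∀ p n, Continuous fun x => kraus d σsq x p n := fun p n =>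
    (continuous_apply n).comp ((continuous_apply p).comp (continuous_kraus hd hσ))
  have e : ∀ x, shiftForm hd i a (kraus d σsq x *ᵥ φ) * cis (-(j * (x / √d))) =
      ∑ p : Label d, ∑ n : Label d, ∑ n' : Label d, (a p * conj (φ n) * φ n') *
        (conj (kraus d σsq x p n) * kraus d σsq x (Label.shift hd i p) n' *
          cis (-(j * (x / √d)))) := fun x => by
    simp only [shiftForm, Matrix.mulVec, dotProduct, map_sum, map_mul, Finset.mul_sum,
      Finset.sum_mul]
    refine Finset.sum_congr rfl fun p _ => ?_
    rw [Finset.sum_comm]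
    refine Finset.sum_congr rfl fun n _ => Finset.sum_congr rfl fun n' _ => by ring
  have hc : ∀ p n n', IntegrableOn (fun x => (a p * conj (φ n) * φ n') *
        (conj (kraus d σsq x p n) * kraus d σsq x (Label.shift hd i p) n' *
          cis (-(j * (x / √d))))) (Set.Icc (-(√d / 2)) (√d / 2)) := fun p n n' => by
    refine Continuous.integrableOn_Icc ?_
    exact continuous_const.mul (((Complex.continuous_conj.comp (hK p n)).mul (hK _ n')).mul
      (continuous_cis.comp (by fun_prop)))
  simp only [e]
  rw [integral_finsetSum _ fun p _ => integrable_finsetSum _ fun n _ =>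
    integrable_finsetSum _ fun n' _ => hc p n n']
  have e2 : ∀ p, ∫ x in Set.Icc (-(√d / 2)) (√d / 2), ∑ n : Label d, ∑ n' : Label d,
      (a p * conj (φ n) * φ n') *
        (conj (kraus d σsq x p n) * kraus d σsq x (Label.shift hd i p) n' *
          cis (-(j * (x / √d)))) =
      ∑ n : Label d, (krausCorr d σsq j ((p : ℤ) - n) : ℂ) * a p *
        (conj (φ n) * φ (Label.shift hd (i + j) n)) := fun p => by
    rw [integral_finsetSum _ fun n _ => integrable_finsetSum _ fun n' _ => hc p n n']
    refine Finset.sum_congr rfl fun n _ => ?_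
    rw [integral_finsetSum _ fun n' _ => hc p n n']
    simp only [integral_const_mul, setIntegral_kraus hd hσ, mul_ite, mul_zero,
      Finset.sum_ite_eq', Finset.mem_univ, if_true]
    ring
  simp only [e2]
  rw [Finset.sum_comm]
  simp only [shiftForm, Finset.sum_mul]

/-! ### The evolution -/

lemma evolution_mulVec (hd : Odd d) (τ : ℝ) (φ : Label d → ℂ) (p : Label d) :
    (evolution d (τ / √d) *ᵥ φ) p = cis (-(τ * ((p : ℤ) : ℝ) / d)) * φ p := by
  have hd' : (0 : ℝ) < d := by exact_mod_cast hd.pos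
  rw [evolution, hamiltonian, ← Matrix.diagonal_smul, Matrix.exp_diagonal, Matrix.mulVec_diagonal,
    Pi.coe_exp, ← Complex.exp_eq_exp_ℂ, cis]
  congr 2
  have h : τ / √d * (2 * π / √d * ((p : ℤ) : ℝ)) = 2 * π * (τ * ((p : ℤ) : ℝ) / d) := by
    nth_rewrite 3 [← Real.mul_self_sqrt hd'.le]
    field_simp
  rw [Pi.smul_apply, smul_eq_mul, mul_neg, ← h]
  push_cast
  ring

/-- The factor of a step of the random walk. -/
def stepFactor (d : ℕ) (τ : ℝ) (p : Label d) : ℂ :=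
  1 - (1 - cis τ) * (if (p : ℤ) = ((d : ℤ) - 1) / 2 then 1 else 0)

lemma shiftForm_zero_evolution (hd : Odd d) (τ : ℝ) (φ : Label d → ℂ) :
    shiftForm hd 0 (fun _ => 1) (evolution d (τ / √d) *ᵥ φ) = shiftForm hd 0 (fun _ => 1) φ := by
  refine Finset.sum_congr rfl fun p _ => ?_
  simp only [Label.shift_zero, evolution_mulVec hd, map_mul, one_mul]
  rw [mul_mul_mul_comm, Complex.conj_mul', norm_cis]
  simp

/-- Neighbouring levels differ by the same phase, except across the wrap from the top level to the
bottom one. This exception is the whole source of the backaction factor. -/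
lemma shiftForm_one_evolution (hd : Odd d) (τ : ℝ) (a φ : Label d → ℂ) :
    shiftForm hd 1 a (evolution d (τ / √d) *ᵥ φ) =
      cis (-(τ / d)) * shiftForm hd 1 (fun p => stepFactor d τ p * a p) φ := by
  have hd' : (0 : ℝ) < d := by exact_mod_cast hd.pos
  rw [shiftForm, shiftForm, Finset.mul_sum]
  refine Finset.sum_congr rfl fun p _ => ?_
  obtain ⟨l, hl⟩ := Label.shift_eq hd 1 p
  have hb := (Label.shift hd 1 p).bounds hd
  have hp := p.bounds hd
  have h1 : conj (cis (-(τ * ((p : ℤ) : ℝ) / d))) *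
      cis (-(τ * (((Label.shift hd 1 p : Label d) : ℤ) : ℝ) / d)) =
      cis (-(τ / d)) * stepFactor d τ p := by
    rw [← cis_neg, ← cis_add, hl, neg_neg]
    have : τ * ((p : ℤ) : ℝ) / d + -(τ * (((p : ℤ) + 1 + l * d : ℤ) : ℝ) / d) =
        -(τ / d) + -(τ * l) := by
      push_cast; field_simp; ring
    rw [this, cis_add, stepFactor]
    congr 1
    obtain ⟨k, rfl⟩ := hd
    have hn : (0 : ℤ) < ((2 * k + 1 : ℕ) : ℤ) := by positivity
    have hl0 : l < 0 ∨ l = 0 ∨ 0 < l := lt_trichotomy l 0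
    -- The shift of the top label wraps once (l = -1) and produces `cis τ`; for all other labels l =
    -- 0.
    split_ifs with h
    · have : l = -1 := by
        rcases lt_trichotomy l (-1) with h' | h' | h'
        · have := mul_le_mul_of_nonneg_right (show l ≤ -2 by omega) hn.le
          push_cast at *
          omega
        · exact h'
        · have := mul_nonneg (show 0 ≤ l by omega) hn.le
          push_cast at *
          omega
      rw [this]
      simp
    · have : l = 0 := by
        rcases hl0 with h' | h' | h'
        · have := mul_le_mul_of_nonneg_right (show l ≤ -1 by omega) hn.le
          push_cast at *
          omega
        · exact h'
        · have := mul_le_mul_of_nonneg_right (show 1 ≤ l by omega) hn.le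
          push_cast at *
          omega
      rw [this]
      simp [cis_zero]
  rw [evolution_mulVec hd, evolution_mulVec hd, map_mul]
  linear_combination (a p * (conj (φ p) * φ (Label.shift hd 1 p))) * h1

/-! ### Iterated integrals -/

lemma setIntegral_Icc_snoc {J : ℕ} {L : ℝ} {F : (Fin J → ℝ) → ℝ → ℂ}
    (hF : Continuous fun x : (Fin J → ℝ) × ℝ => F x.1 x.2) :
    ∫ x in Set.Icc (fun _ : Fin (J + 1) => -L) (fun _ => L), F (Fin.init x) (x (Fin.last J)) =
      ∫ y in Set.Icc (fun _ : Fin J => -L) (fun _ => L), ∫ t in Set.Icc (-L) L, F y t := by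
  have hmp := (volume_preserving_piFinSuccAbove (fun _ : Fin (J + 1) => ℝ) (Fin.last J)).symm
  have hpre : (MeasurableEquiv.piFinSuccAbove (fun _ : Fin (J + 1) => ℝ) (Fin.last J)).symm ⁻¹'
      Set.Icc (fun _ : Fin (J + 1) => -L) (fun _ => L) =
      Set.Icc (-L) L ×ˢ Set.Icc (fun _ : Fin J => -L) (fun _ => L) := by
    ext ⟨t, y⟩
    simp only [Set.mem_preimage, Set.mem_Icc, Set.mem_prod, Pi.le_def, Fin.forall_fin_succ']
    simp [MeasurableEquiv.piFinSuccAbove]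
    tauto
  rw [← hmp.setIntegral_preimage_emb (MeasurableEquiv.measurableEmbedding _), hpre,
    Measure.volume_eq_prod, ← setIntegral_prod_swap,
    ← setIntegral_prod (fun z : (Fin J → ℝ) × ℝ => F z.1 z.2)
      (hF.continuousOn.integrableOn_compact (isCompact_Icc.prod isCompact_Icc))]
  refine integral_congr_ae (ae_of_all _ fun z => ?_)
  have h : Fin.init ((Fin.snocEquiv fun _ : Fin (J + 1) => ℝ) z.swap) = z.1 :=
    Fin.init_snoc (α := fun _ => ℝ) z.2 z.1
  simp [MeasurableEquiv.piFinSuccAbove, h]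

lemma continuous_measuredState (hd : Odd d) (ξsq : ℝ) {σsq : ℝ} (hσ : 0 < σsq) (n₀ : ℤ)
    (δ : ℕ → ℝ) (J : ℕ) : Continuous (measuredState d ξsq σsq n₀ δ J) := by
  induction J with
  | zero => exact continuous_const
  | succ J ih =>
    have h1 : Continuous fun x : Fin (J + 1) → ℝ => Fin.init x :=
      continuous_pi fun i => continuous_apply _
    have h2 : Continuous fun x : Fin (J + 1) → ℝ => kraus d σsq (x (Fin.last J)) :=
      (continuous_kraus hd hσ).comp (continuous_apply _)
    have h3 : Continuous fun x : Fin (J + 1) → ℝ =>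
        evolution d (δ (J + 1) / √d) *ᵥ measuredState d ξsq σsq n₀ δ J (Fin.init x) :=
      continuous_const.matrix_mulVec (ih.comp h1)
    exact h2.matrix_mulVec h3

/-- One step of the recursion; g carries whatever depends on the earlier outcomes. -/
lemma setIntegral_measuredState_succ (hd : Odd d) (ξsq : ℝ) {σsq : ℝ} (hσ : 0 < σsq) (n₀ : ℤ)
    (δ : ℕ → ℝ) (J : ℕ) (i j : ℤ) (a : Label d → ℂ) {g : (Fin J → ℝ) → ℂ} (hg : Continuous g) :
    ∫ x in Set.Icc (fun _ : Fin (J + 1) => -(√d / 2)) (fun _ => √d / 2),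
      g (Fin.init x) * (shiftForm hd i a (measuredState d ξsq σsq n₀ δ (J + 1) x) *
        cis (-(j * (x (Fin.last J) / √d)))) =
    ∫ y in Set.Icc (fun _ : Fin J => -(√d / 2)) (fun _ => √d / 2),
      g y * shiftForm hd (i + j)
        (fun n => ∑ p : Label d, (krausCorr d σsq j ((p : ℤ) - n) : ℂ) * a p)
        (evolution d (δ (J + 1) / √d) *ᵥ measuredState d ξsq σsq n₀ δ J y) := by
  have hc := continuous_measuredState hd ξsq hσ n₀ δ J
  have h := setIntegral_Icc_snoc (J := J) (L := √d / 2) (F := fun y t =>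
    g y * (shiftForm hd i a (kraus d σsq t *ᵥ
      (evolution d (δ (J + 1) / √d) *ᵥ measuredState d ξsq σsq n₀ δ J y)) *
        cis (-(j * (t / √d))))) (by
    refine (hg.comp continuous_fst).mul (((continuous_shiftForm hd i a).comp ?_).mul
      (continuous_cis.comp (by fun_prop)))
    exact ((continuous_kraus hd hσ).comp continuous_snd).matrix_mulVec
      (continuous_const.matrix_mulVec (hc.comp continuous_fst)))
  refine h.trans ?_
  simp only [integral_const_mul, setIntegral_shiftForm_kraus hd hσ]

lemma outcomeDensity_eq (hd : Odd d) (ξsq σsq : ℝ) (n₀ : ℤ) (δ : ℕ → ℝ) (J : ℕ)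
    (x : Fin J → ℝ) : (outcomeDensity d ξsq σsq n₀ δ J x : ℂ) =
      shiftForm hd 0 (fun _ => 1) (measuredState d ξsq σsq n₀ δ J x) := by
  rw [outcomeDensity, norm_sq_eq_shiftForm hd]

lemma exp_eq_cis (x y : ℝ) :
    Complex.exp (-(2 * Real.pi * I * (x : ℂ) / (y : ℂ))) = cis (-(x / y)) := by
  rw [cis]; congr 1; push_cast; ring

/-- Later measurements do not affect the distribution of the earlier outcomes. -/
lemma clockMoment_castSucc (hd : Odd d) (ξsq : ℝ) {σsq : ℝ} (hσ : 0 < σsq) (n₀ : ℤ)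
    (δ : ℕ → ℝ) (J : ℕ) (i : Fin J) :
    clockMoment d ξsq σsq n₀ δ (J + 1) i.castSucc = clockMoment d ξsq σsq n₀ δ J i := by
  have h := setIntegral_measuredState_succ hd ξsq hσ n₀ δ J 0 0 (fun _ => 1)
    (g := fun y => cis (-(y i / √d))) (continuous_cis.comp (by fun_prop))
  simp only [clockMoment, outcomeDensity_eq hd, exp_eq_cis]
  simp only [Int.cast_zero, zero_mul, neg_zero, cis_zero, mul_one, ← Complex.ofReal_sum,
    sum_krausCorr hd hσ, tsum_krausProd_zero hd hσ, add_zero, Complex.ofReal_one,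
    shiftForm_zero_evolution] at h
  exact h

/-- The only integration with a nonzero frequency: it turns the trivial weight at shift 0 into the
constant C₂ at shift 1. -/
lemma clockMoment_last (hd : Odd d) (ξsq : ℝ) {σsq : ℝ} (hσ : 0 < σsq) (n₀ : ℤ)
    (δ : ℕ → ℝ) (J : ℕ) :
    clockMoment d ξsq σsq n₀ δ (J + 1) (Fin.last J) = imprecisionFactor d σsq *
      (cis (-(δ (J + 1) / d)) * ∫ y in Set.Icc (fun _ : Fin J => -(√d / 2)) (fun _ => √d / 2),
        shiftForm hd 1 (stepFactor d (δ (J + 1))) (measuredState d ξsq σsq n₀ δ J y)) := by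
  have h := setIntegral_measuredState_succ hd ξsq hσ n₀ δ J 0 1 (fun _ => 1)
    (g := fun _ => 1) continuous_const
  simp only [clockMoment, outcomeDensity_eq hd, exp_eq_cis]
  simp only [Int.cast_one, one_mul, mul_one, ← Complex.ofReal_sum, sum_krausCorr hd hσ,
    tsum_krausProd_one hd hσ, zero_add, shiftForm_one_evolution] at h
  simp only [mul_comm (cis (-(_ / √(d : ℝ))))]
  rw [h]
  simp only [mul_comm _ (imprecisionFactor d σsq), shiftForm_const_mul, integral_const_mul]
  ring

/-- The backward recursion for the random walk. -/
def walkValue (d : ℕ) (σsq τ : ℝ) : ℕ → Label d → ℂ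
  | 0, p => stepFactor d τ p
  | n + 1, p => stepFactor d τ p *
      ∑ q : Label d, (walkJump d σsq ((q : ℤ) - p) : ℂ) * walkValue d σsq τ n q

/-- Each measurement removed turns `walkValue` n into `walkValue` (n + 1) and releases one phase, so
the induction needs n arbitrary. -/
lemma setIntegral_walkValue (hd : Odd d) (ξsq : ℝ) {σsq : ℝ} (hσ : 0 < σsq) (n₀ : ℤ)
    (τ : ℝ) (J : ℕ) (n : ℕ) :
    ∫ y in Set.Icc (fun _ : Fin J => -(√d / 2)) (fun _ => √d / 2),
        shiftForm hd 1 (walkValue d σsq τ n) (measuredState d ξsq σsq n₀ (fun _ => τ) J y) =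
      cis (-(τ / d)) ^ J * shiftForm hd 1 (walkValue d σsq τ (n + J)) (initialState d ξsq n₀) := by
  induction J generalizing n with
  | zero =>
    simp only [measuredState, integral_const]
    -- With no outcomes left, the domain is a point of volume 1.
    rw [measureReal_restrict_apply_univ, Measure.real, Real.volume_Icc_pi]
    simp
  | succ J ih =>
    have h := setIntegral_measuredState_succ hd ξsq hσ n₀ (fun _ => τ) J 1 0 (walkValue d σsq τ n)
      (g := fun _ => 1) continuous_const
    simp only [Int.cast_zero, zero_mul, neg_zero, cis_zero, mul_one, one_mul, add_zero,
      shiftForm_one_evolution, (krausCorr_zero hd hσ _).1, integral_const_mul] at h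
    have e : (fun p => stepFactor d τ p *
        ∑ q : Label d, (walkJump d σsq ((q : ℤ) - p) : ℂ) * walkValue d σsq τ n q) =
        walkValue d σsq τ (n + 1) := rfl
    rw [h, e, ih, pow_succ, show n + (J + 1) = n + 1 + J by ring]
    ring

end Moment

section Exact

variable {d : ℕ}

/-! ### The backaction factor -/

/-- Backward evaluation of the expectation of a product over a Markov chain. -/
lemma sum_chain_eq {α : Type*} [Fintype α] (K : α → α → ℂ) (F : α → ℂ) (V : ℕ → α → ℂ)
    (hV0 : ∀ p, V 0 p = F p) (hV : ∀ n p, V (n + 1) p = F p * ∑ q, K p q * V n q) (N : ℕ)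
    (W : α → ℂ) :
    ∑ p : Fin (N + 1) → α, (W (p 0) * ∏ j : Fin N, K (p j.castSucc) (p j.succ)) *
      ∏ j : Fin (N + 1), F (p j) = ∑ p, W p * V N p := by
  induction N generalizing W with
  | zero =>
    rw [← (Equiv.funUnique (Fin 1) α).sum_comp]
    simp [hV0]
  | succ N ih =>
    rw [← (Fin.consEquiv fun _ : Fin (N + 2) => α).sum_comp, Fintype.sum_prod_type_right]
    -- The first position is summed out: W is pushed forward by one step and becomes the weight of
    -- the shorter chain.
    have h := ih fun q => ∑ p, W p * F p * K p q
    calc _ = ∑ y : Fin (N + 1) → α, ((∑ p, W p * F p * K p (y 0)) *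
          ∏ j : Fin N, K (y j.castSucc) (y j.succ)) * ∏ j : Fin (N + 1), F (y j) := by
          refine Finset.sum_congr rfl fun y _ => ?_
          rw [Finset.sum_mul, Finset.sum_mul]
          refine Finset.sum_congr rfl fun x _ => ?_
          rw [Fin.prod_univ_succ, Fin.prod_univ_succ (n := N + 1)]
          simp only [Fin.consEquiv_apply, Fin.cons_zero, Fin.cons_succ, Fin.castSucc_zero,
            ← Fin.succ_castSucc]
          ring
      _ = _ := by
          rw [h]
          simp only [hV, Finset.sum_mul, Finset.mul_sum]
          rw [Finset.sum_comm]
          refine Finset.sum_congr rfl fun p _ => Finset.sum_congr rfl fun q _ => by ring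

lemma backactionFactor_eq (d : ℕ) (ξsq σsq : ℝ) (n₀ : ℤ) (τ : ℝ) (N : ℕ) :
    backactionFactor d ξsq σsq n₀ (fun _ => τ) N =
      ∑ p : Label d, (walkInitial d ξsq n₀ p : ℂ) * walkValue d σsq τ N p := by
  rw [← sum_chain_eq (fun p q : Label d => (walkJump d σsq ((q : ℤ) - p) : ℂ)) (stepFactor d τ)
    (walkValue d σsq τ) (fun _ => rfl) (fun _ _ => rfl)]
  have h : Complex.exp (2 * Real.pi * I * (τ : ℂ)) = cis τ := by
    rw [cis]; congr 1; push_cast; ring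
  simp only [backactionFactor, h, stepFactor]
  push_cast
  rfl

/-! ### The initial state -/

lemma sum_theta_mul_cis (hd : Odd d) {s : ℝ} (hs : 0 < s) (q : ℤ) :
    ∑ k : Label d, (theta (((k : ℤ) : ℝ) / d) s : ℂ) * cis (((k : ℤ) : ℝ) * ((-q : ℤ) : ℝ) / d) =
      d * (wrapGauss (π * s) d q : ℂ) := by
  have hd0 : (d : ℤ) ≠ 0 := by exact_mod_cast hd.pos.ne'
  have h := hasSum_sum (s := Finset.univ) fun (k : Label d) _ =>
    (hasSum_theta hs (((k : ℤ) : ℝ) / d)).mul_right (cis (((k : ℤ) : ℝ) * ((-q : ℤ) : ℝ) / d))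
  have e : ∀ m : ℤ, ∑ k : Label d, ((Real.exp (-(π * s * m ^ 2)) : ℝ) : ℂ) *
      cis (m * (((k : ℤ) : ℝ) / d)) * cis (((k : ℤ) : ℝ) * ((-q : ℤ) : ℝ) / d) =
      ((Real.exp (-(π * s * m ^ 2)) : ℝ) : ℂ) * if (d : ℤ) ∣ m - q then (d : ℂ) else 0 :=
    fun m => by
      rw [← sum_label_cis hd, Finset.mul_sum]
      refine Finset.sum_congr rfl fun k _ => ?_
      rw [mul_assoc, ← cis_add]
      congr 2
      push_cast
      ring
  simp only [e] at h
  have inj : Function.Injective fun l : ℤ => q + l * d := fun l k h =>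
    mul_right_cancel₀ hd0 (add_left_cancel h)
  rw [← inj.hasSum_iff] at h
  · rw [← h.tsum_eq, wrapGauss, Complex.ofReal_tsum, ← tsum_mul_left]
    refine tsum_congr fun l => ?_
    simp only [Function.comp]
    rw [if_pos ⟨l, by ring⟩]
    push_cast
    ring
  · intro m hm
    rw [if_neg, mul_zero]
    rintro ⟨k, hk⟩
    exact hm ⟨k, by simp only; linarith⟩

/-- The amplitude scale of the initial state in the energy eigenbasis. -/
def initialScale (d : ℕ) (ξsq : ℝ) : ℝ :=
  √(2 / d) / √(theta 0 (ξsq / (2 * d)) * theta 0 (d * ξsq / 2) +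
    theta (1 / 2) (ξsq / (2 * d)) * theta (d / 2) (d * ξsq / 2)) * (1 / √ξsq)

/-- The discrete Fourier transform of a sampled theta function is a wrapped Gaussian, here centred
at n₀. The amplitudes are real, so no phase appears in the overlap of neighbours. -/
lemma initialState_apply (hd : Odd d) {ξsq : ℝ} (hξ : 0 < ξsq) (n₀ : ℤ) (p : Label d) :
    initialState d ξsq n₀ p =
      ((initialScale d ξsq * theta ((((p : ℤ) - n₀ : ℤ) : ℝ) / d) (1 / (ξsq * d)) : ℝ) : ℂ) := by
  have hd' : (0 : ℝ) < d := by exact_mod_cast hd.pos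
  have hsq : √(d : ℝ) ≠ 0 := (Real.sqrt_pos.mpr hd').ne'
  set R := √(2 / d) / √(theta 0 (ξsq / (2 * d)) * theta 0 (d * ξsq / 2) +
    theta (1 / 2) (ξsq / (2 * d)) * theta (d / 2) (d * ξsq / 2)) with hR
  have e : ∀ k : Label d, initialCoeff d ξsq n₀ k * timeState d k p =
      ((R * (1 / √d) : ℝ) : ℂ) * ((theta (((k : ℤ) : ℝ) / d) (ξsq / d) : ℂ) *
        cis (((k : ℤ) : ℝ) * ((-((p : ℤ) - n₀) : ℤ) : ℝ) / d)) := fun k => by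
    rw [initialCoeff, timeState, ← hR, show ((k : ℤ) : ℝ) * ((-((p : ℤ) - n₀) : ℤ) : ℝ) / d =
      n₀ * ((k : ℤ) : ℝ) / d + -(((k : ℤ) : ℝ) * ((p : ℤ) : ℝ) / d) by push_cast; ring, cis_add,
      cis, cis]
    rw [show (((2 * π * ((n₀ : ℝ) * ((k : ℤ) : ℝ) / d) : ℝ) : ℂ) * I) =
      2 * Real.pi * I * (n₀ : ℂ) * ((k : ℤ) : ℂ) / (d : ℂ) by push_cast; ring,
      show (((2 * π * -(((k : ℤ) : ℝ) * ((p : ℤ) : ℝ) / d) : ℝ) : ℂ) * I) =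
      -(2 * Real.pi * I * ((k : ℤ) : ℂ) * ((p : ℤ) : ℂ) / (d : ℂ)) by push_cast; ring]
    push_cast
    ring
  rw [initialState, Finset.sum_apply]
  simp only [Pi.smul_apply, smul_eq_mul, e]
  rw [← Finset.mul_sum, sum_theta_mul_cis hd (by positivity), wrapGauss_eq (by positivity) hd.pos,
    initialScale, ← hR, show π / (π * (ξsq / d) * (d : ℝ) ^ 2) = 1 / (ξsq * d) by field_simp]
  have h2 : (1 / √d) * (d * √(1 / (ξsq * d))) = 1 / √ξsq := by
    rw [Real.sqrt_div zero_le_one, Real.sqrt_one, Real.sqrt_mul hξ.le]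
    have : √ξsq ≠ 0 := (Real.sqrt_pos.mpr hξ).ne'
    field_simp
    rw [Real.sq_sqrt hd'.le]
  rw [← h2]
  push_cast
  ring

lemma theta_half_odd (hd : Odd d) (s : ℝ) : theta (d / 2) s = theta (1 / 2) s := by
  obtain ⟨k, rfl⟩ := hd
  rw [show (((2 * k + 1 : ℕ) : ℝ) / 2) = 1 / 2 + ((k : ℤ) : ℝ) by push_cast; ring, theta_add_int]

/-- The denominator of `waveFactor`. -/
def overlapNorm (d : ℕ) (ξsq : ℝ) : ℝ :=
  theta 0 (1 / (2 * ξsq * d)) * theta 0 (d / (2 * ξsq)) +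
    theta (1 / 2) (1 / (2 * ξsq * d)) * theta (1 / 2) (d / (2 * ξsq))

/-- The normalization is given in the time basis, C₁ in the energy basis. Duplication sends each
pair (u, v) to a multiple of (u+v, u-v), and (u+v)(s+t) + (u-v)(s-t) = 2(us+vt), so the two
expressions agree up to a factor ξ². -/
lemma initialScale_sq (hd : Odd d) {ξsq : ℝ} (hξ : 0 < ξsq) :
    initialScale d ξsq ^ 2 = 2 / d / overlapNorm d ξsq := by
  have hd' : (0 : ℝ) < d := by exact_mod_cast hd.pos
  obtain ⟨h1, h2⟩ := theta_dual (b := ξsq / (2 * d)) (by positivity)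
  obtain ⟨h3, h4⟩ := theta_dual (b := d * ξsq / 2) (by positivity)
  rw [show 1 / (4 * (ξsq / (2 * d))) = d / (2 * ξsq) by field_simp; norm_num] at h1 h2
  rw [show 1 / (4 * (d * ξsq / 2)) = 1 / (2 * ξsq * d) by field_simp; norm_num] at h3 h4
  have h5 : √(ξsq / (2 * d)) * √(d * ξsq / 2) = ξsq / 2 := by
    rw [← Real.sqrt_mul (by positivity), show ξsq / (2 * d) * (d * ξsq / 2) = (ξsq / 2) ^ 2 by
      field_simp, Real.sqrt_sq (by positivity)]
  have h6 : overlapNorm d ξsq = ξsq * (theta 0 (ξsq / (2 * d)) * theta 0 (d * ξsq / 2) +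
      theta (1 / 2) (ξsq / (2 * d)) * theta (1 / 2) (d * ξsq / 2)) := by
    rw [overlapNorm, h1, h2, h3, h4]
    linear_combination (2 * (theta 0 (ξsq / (2 * d)) * theta 0 (d * ξsq / 2) +
      theta (1 / 2) (ξsq / (2 * d)) * theta (1 / 2) (d * ξsq / 2))) * h5
  have p1 := theta_pos (s := ξsq / (2 * d)) (by positivity)
  have p2 := theta_pos (s := d * ξsq / 2) (by positivity)
  have h7 : 0 < theta 0 (ξsq / (2 * d)) * theta 0 (d * ξsq / 2) +
      theta (1 / 2) (ξsq / (2 * d)) * theta (1 / 2) (d * ξsq / 2) :=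
    add_pos (mul_pos (p1 _) (p2 _)) (mul_pos (p1 _) (p2 _))
  rw [initialScale, theta_half_odd hd, mul_pow, div_pow, Real.sq_sqrt (by positivity),
    Real.sq_sqrt h7.le, div_pow, Real.sq_sqrt hξ.le, h6]
  field_simp

/-- Translation invariance on the ring removes n₀; the identity makes the initial law of the walk
sum to 1. -/
lemma overlapSum_eq (hd : Odd d) {ξsq : ℝ} (hξ : 0 < ξsq) (n₀ : ℤ) :
    (d : ℝ) / 2 * overlapSum d ξsq =
      ∑ p : Label d, theta ((((p : ℤ) - n₀ + 1 : ℤ) : ℝ) / d) (1 / (ξsq * d)) *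
        theta ((((p : ℤ) - n₀ : ℤ) : ℝ) / d) (1 / (ξsq * d)) := by
  have hd' : (0 : ℝ) < d := by exact_mod_cast hd.pos
  have h := sum_theta_mul_theta hd (s := 1 / (ξsq * d)) (by positivity) (1 / d)
  have h2 := sum_label_add hd (fun m : ℤ => theta (((m + 1 : ℤ) : ℝ) / d) (1 / (ξsq * d)) *
    theta ((m : ℝ) / d) (1 / (ξsq * d))) (fun m l => by
      rw [show (((m + l * d + 1 : ℤ) : ℝ) / d) = ((m + 1 : ℤ) : ℝ) / d + (l : ℝ) by
        push_cast; field_simp; ring,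
        show (((m + l * d : ℤ) : ℝ) / d) = (m : ℝ) / d + (l : ℝ) by push_cast; field_simp,
        theta_add_int, theta_add_int]) (-n₀)
  simp only [← sub_eq_add_neg] at h2
  rw [h2, overlapSum]
  have e1 : (d : ℝ) * (1 / d) / 2 = 1 / 2 := by field_simp
  have e2 : (d : ℝ) ^ 2 * (1 / (ξsq * d)) / 2 = d / (2 * ξsq) := by field_simp
  have e3 : (1 / (d : ℝ)) / 2 = 1 / (2 * d) := by field_simp
  have e4 : 1 / (ξsq * (d : ℝ)) / 2 = 1 / (2 * ξsq * d) := by field_simp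
  have e5 : theta (1 / 2 + 1 / 2) (d / (2 * ξsq)) = theta 0 (d / (2 * ξsq)) := by
    rw [show (1 : ℝ) / 2 + 1 / 2 = 0 + 1 by norm_num, theta_add_one]
  rw [e1, e2, e3, e4, e5] at h
  have e6 : ∀ p : Label d, theta ((((p : ℤ) + 1 : ℤ) : ℝ) / d) (1 / (ξsq * d)) *
      theta (((p : ℤ) : ℝ) / d) (1 / (ξsq * d)) = theta (((p : ℤ) : ℝ) / d) (1 / (ξsq * d)) *
      theta (((p : ℤ) : ℝ) / d + 1 / d) (1 / (ξsq * d)) := fun p => by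
    rw [mul_comm, ← add_div]; push_cast; rfl
  simp only [e6]
  rw [h]
  ring

lemma overlapSum_pos (hd : Odd d) {ξsq : ℝ} (hξ : 0 < ξsq) : 0 < overlapSum d ξsq := by
  have hd' : (0 : ℝ) < d := by exact_mod_cast hd.pos
  have p1 := theta_pos (s := 1 / (2 * ξsq * d)) (by positivity)
  have p2 := theta_pos (s := d / (2 * ξsq)) (by positivity)
  exact add_pos (mul_pos (p1 _) (p2 _)) (mul_pos (p1 _) (p2 _))

lemma overlapNorm_pos (hd : Odd d) {ξsq : ℝ} (hξ : 0 < ξsq) : 0 < overlapNorm d ξsq := by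
  have hd' : (0 : ℝ) < d := by exact_mod_cast hd.pos
  have p1 := theta_pos (s := 1 / (2 * ξsq * d)) (by positivity)
  have p2 := theta_pos (s := d / (2 * ξsq)) (by positivity)
  exact add_pos (mul_pos (p1 _) (p2 _)) (mul_pos (p1 _) (p2 _))

lemma shiftForm_initialState (hd : Odd d) {ξsq : ℝ} (hξ : 0 < ξsq) (n₀ : ℤ) (a : Label d → ℂ) :
    shiftForm hd 1 a (initialState d ξsq n₀) =
      waveFactor d ξsq * ∑ p : Label d, (walkInitial d ξsq n₀ p : ℂ) * a p := by
  have hd' : (0 : ℝ) < d := by exact_mod_cast hd.pos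
  have hS := overlapSum_pos hd hξ
  have hN := overlapNorm_pos hd hξ
  rw [shiftForm, Finset.mul_sum]
  refine Finset.sum_congr rfl fun p _ => ?_
  obtain ⟨l, hl⟩ := Label.shift_eq hd 1 p
  have e : theta (((((Label.shift hd 1 p : Label d) : ℤ) - n₀ : ℤ) : ℝ) / d) (1 / (ξsq * d)) =
      theta ((((p : ℤ) - n₀ + 1 : ℤ) : ℝ) / d) (1 / (ξsq * d)) := by
    rw [hl, show ((((p : ℤ) + 1 + l * d - n₀ : ℤ) : ℝ) / d) =
      (((p : ℤ) - n₀ + 1 : ℤ) : ℝ) / d + (l : ℝ) by push_cast; field_simp; ring, theta_add_int]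
  have h2 : ∀ x y : ℝ, (initialScale d ξsq * x) * (initialScale d ξsq * y) =
      waveFactor d ξsq * (y * x / ((d : ℝ) / 2 * overlapSum d ξsq)) := fun x y => by
    rw [waveFactor, ← overlapNorm, mul_mul_mul_comm, ← sq, initialScale_sq hd hξ]
    field_simp
  rw [initialState_apply hd hξ, initialState_apply hd hξ, Complex.conj_ofReal,
    ← Complex.ofReal_mul, h2, e, walkInitial]
  push_cast
  ring

/-- The exact factorization of the expected clock reading. -/
lemma clockMoment_eq (hd : Odd d) {ξsq σsq : ℝ} (hξ : 0 < ξsq) (hσ : 0 < σsq) (n₀ : ℤ) (τ : ℝ)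
    {N J : ℕ} (h : N < J) :
    clockMoment d ξsq σsq n₀ (fun _ => τ) J ⟨N, h⟩ = cis (-(τ / d)) ^ (N + 1) *
      waveFactor d ξsq * imprecisionFactor d σsq *
        backactionFactor d ξsq σsq n₀ (fun _ => τ) N := by
  induction J, h using Nat.le_induction with
  | base =>
    have h1 := clockMoment_last hd ξsq hσ n₀ (fun _ => τ) N
    have h2 := setIntegral_walkValue hd ξsq hσ n₀ τ N 0
    have h3 : walkValue d σsq τ 0 = stepFactor d τ := rfl
    rw [h3, zero_add, shiftForm_initialState hd hξ, ← backactionFactor_eq] at h2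
    rw [h2] at h1
    refine h1.trans ?_
    ring
  | succ J hJ ih =>
    exact (clockMoment_castSucc hd ξsq hσ n₀ (fun _ => τ) J ⟨N, hJ⟩).trans ih

end Exact

section Backaction

variable {d : ℕ}

/-! ### The random walk rarely hits the edge of the spectrum -/

lemma stepFactor_half_of_ne {p : Label d} (h : (p : ℤ) ≠ ((d : ℤ) - 1) / 2) :
    stepFactor d (1 / 2) p = 1 := by
  simp [stepFactor, h]

lemma norm_stepFactor_half (p : Label d) : ‖stepFactor d (1 / 2) p‖ = 1 := by
  rw [stepFactor, cis_half]
  split_ifs <;> norm_num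

lemma walkJump_nonneg (hd : Odd d) {σsq : ℝ} (hσ : 0 < σsq) (q : ℤ) : 0 ≤ walkJump d σsq q := by
  have hd' : (0 : ℝ) < d := by exact_mod_cast hd.pos
  rw [(krausCorr_zero hd hσ q).2]
  exact div_nonneg (wrapGauss_pos (by positivity) hd.pos q).le (theta_pos (by positivity) 0).le

lemma sum_walkJump (hd : Odd d) {σsq : ℝ} (hσ : 0 < σsq) (p : Label d) :
    ∑ q : Label d, walkJump d σsq ((q : ℤ) - p) = 1 := by
  simp only [← (krausCorr_zero hd hσ _).1]
  rw [sum_krausCorr hd hσ, tsum_krausProd_zero hd hσ]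

lemma norm_walkValue_le_one (hd : Odd d) {σsq : ℝ} (hσ : 0 < σsq) (n : ℕ) (p : Label d) :
    ‖walkValue d σsq (1 / 2) n p‖ ≤ 1 := by
  induction n generalizing p with
  | zero => exact (norm_stepFactor_half p).le
  | succ n ih =>
    rw [walkValue, norm_mul, norm_stepFactor_half, one_mul]
    refine le_of_le_of_eq ?_ (sum_walkJump hd hσ p)
    refine norm_sum_le_of_le _ fun q _ => ?_
    rw [norm_mul, Complex.norm_real, Real.norm_of_nonneg (walkJump_nonneg hd hσ _)]
    exact mul_le_of_le_one_right (walkJump_nonneg hd hσ _) (ih q)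

/-- The theta factor of the moment bound is exactly the normalization of the jump law, so a step
costs only e^v. A constant larger than 1 would compound over the steps. -/
lemma sum_walkJump_mul_exp_le (hd : Odd d) {σsq : ℝ} (hσ : 0 < σsq) (r : ℝ) (p : Label d) :
    ∑ q : Label d, walkJump d σsq ((q : ℤ) - p) *
        (Real.exp (r * ((q : ℤ) + 1 / 2)) + Real.exp (-r * ((q : ℤ) + 1 / 2))) ≤
      Real.exp (r ^ 2 / (4 * (2 * π * σsq / d))) *
        (Real.exp (r * ((p : ℤ) + 1 / 2)) + Real.exp (-r * ((p : ℤ) + 1 / 2))) := by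
  have hd' : (0 : ℝ) < d := by exact_mod_cast hd.pos
  have h := sum_wrapGauss_mul_exp_le (a := 2 * π * σsq / d) (by positivity) hd p (x := 1 / 2)
    (by norm_num) r
  rw [show 2 * π * σsq / d / π = 2 * σsq / d by field_simp] at h
  have hθ := theta_pos (s := 2 * σsq / d) (by positivity) 0
  simp only [(krausCorr_zero hd hσ _).2, div_mul_eq_mul_div, ← Finset.sum_div]
  rw [div_le_iff₀ hθ]
  exact h

/-- The right side is a supersolution of the recursion for 1 - `walkValue`: at the top label it is
at least 2, which bounds the left side trivially, and elsewhere averaging over a jump costs e^v,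
which the next n provides. No union bound over the steps is needed. -/
lemma norm_one_sub_walkValue_le (hd : Odd d) {σsq : ℝ} (hσ : 0 < σsq) (r : ℝ) (n : ℕ)
    (p : Label d) :
    ‖1 - walkValue d σsq (1 / 2) n p‖ ≤
      2 * Real.exp (n * (r ^ 2 / (4 * (2 * π * σsq / d))) - r * (d / 2)) *
        (Real.exp (r * ((p : ℤ) + 1 / 2)) + Real.exp (-r * ((p : ℤ) + 1 / 2))) := by
  have hd' : (0 : ℝ) < d := by exact_mod_cast hd.pos
  have hv : 0 ≤ r ^ 2 / (4 * (2 * π * σsq / d)) := by positivity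
  set v := r ^ 2 / (4 * (2 * π * σsq / d)) with hvdef
  by_cases hp : (p : ℤ) = ((d : ℤ) - 1) / 2
  · have h1 : ‖1 - walkValue d σsq (1 / 2) n p‖ ≤ 2 := by
      refine (norm_sub_le _ _).trans ?_
      have := norm_walkValue_le_one hd hσ n p
      rw [norm_one]; linarith
    have h2 : ((p : ℤ) : ℝ) + 1 / 2 = d / 2 := by
      have : 2 * (p : ℤ) + 1 = d := by obtain ⟨k, rfl⟩ := hd; push_cast at hp ⊢; omega
      have : 2 * ((p : ℤ) : ℝ) + 1 = d := by exact_mod_cast this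
      linarith
    rw [h2]
    have h3 : 1 ≤ Real.exp (n * v - r * (d / 2)) * Real.exp (r * (d / 2)) := by
      rw [← Real.exp_add]
      exact Real.one_le_exp (by ring_nf; positivity)
    have h4 : 0 ≤ Real.exp (n * v - r * (d / 2)) * Real.exp (-r * (d / 2)) := by positivity
    rw [mul_assoc, mul_add]
    linarith
  · cases n with
    | zero =>
      rw [walkValue, stepFactor_half_of_ne hp, sub_self, norm_zero]
      positivity
    | succ n =>
      have ih := norm_one_sub_walkValue_le hd hσ r n
      rw [← hvdef] at ih
      have h1 : 1 - walkValue d σsq (1 / 2) (n + 1) p = ∑ q : Label d,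
          (walkJump d σsq ((q : ℤ) - p) : ℂ) * (1 - walkValue d σsq (1 / 2) n q) := by
        simp only [mul_sub, mul_one, Finset.sum_sub_distrib, ← Complex.ofReal_sum,
          sum_walkJump hd hσ]
        rw [walkValue, stepFactor_half_of_ne hp, one_mul, Complex.ofReal_one]
      rw [h1]
      calc _ ≤ ∑ q : Label d, walkJump d σsq ((q : ℤ) - p) *
            (2 * Real.exp (n * v - r * (d / 2)) *
        (Real.exp (r * ((q : ℤ) + 1 / 2)) + Real.exp (-r * ((q : ℤ) + 1 / 2)))) := by
            refine norm_sum_le_of_le _ fun q _ => ?_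
            rw [norm_mul, Complex.norm_real, Real.norm_of_nonneg (walkJump_nonneg hd hσ _)]
            exact mul_le_mul_of_nonneg_left (ih q) (walkJump_nonneg hd hσ _)
        _ = 2 * Real.exp (n * v - r * (d / 2)) * ∑ q : Label d, walkJump d σsq ((q : ℤ) - p) *
            (Real.exp (r * ((q : ℤ) + 1 / 2)) + Real.exp (-r * ((q : ℤ) + 1 / 2))) := by
            rw [Finset.mul_sum]
            exact Finset.sum_congr rfl fun q _ => by ring
        _ ≤ 2 * Real.exp (n * v - r * (d / 2)) * (Real.exp v *
            (Real.exp (r * ((p : ℤ) + 1 / 2)) + Real.exp (-r * ((p : ℤ) + 1 / 2)))) := by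
            have := sum_walkJump_mul_exp_le hd hσ r p
            gcongr
        _ = _ := by
            rw [show ((n + 1 : ℕ) : ℝ) * v - r * (d / 2) = (n * v - r * (d / 2)) + v by
              push_cast; ring, Real.exp_add _ v]
            ring

lemma norm_one_sub_walkValue_le_of_abs_le (hd : Odd d) {σsq : ℝ} (hσ : 0 < σsq) {r : ℝ}
    (hr : 0 ≤ r) {n : ℕ} {M Y : ℝ} (hn : n ≤ M) {p : Label d} (hp : |((p : ℤ) : ℝ)| ≤ Y) :
    ‖1 - walkValue d σsq (1 / 2) n p‖ ≤
      4 * Real.exp (r / 2) *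
        Real.exp (M * (r ^ 2 / (4 * (2 * π * σsq / d))) - r * (d / 2 - Y)) := by
  have hd' : (0 : ℝ) < d := by exact_mod_cast hd.pos
  refine (norm_one_sub_walkValue_le hd hσ r n p).trans ?_
  have hv : 0 ≤ r ^ 2 / (4 * (2 * π * σsq / d)) := by positivity
  set v := r ^ 2 / (4 * (2 * π * σsq / d))
  obtain ⟨h1, h2⟩ := abs_le.mp hp
  have e1 : Real.exp (r * (((p : ℤ) : ℝ) + 1 / 2)) ≤ Real.exp (r * (Y + 1 / 2)) := by gcongr
  have e2 : Real.exp (-r * (((p : ℤ) : ℝ) + 1 / 2)) ≤ Real.exp (r * (Y + 1 / 2)) := by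
    rw [Real.exp_le_exp]; nlinarith
  calc _ ≤ 2 * Real.exp (M * v - r * (d / 2)) *
        (Real.exp (r * (Y + 1 / 2)) + Real.exp (r * (Y + 1 / 2))) := by gcongr
    _ = 4 * (Real.exp (M * v - r * (d / 2)) * Real.exp (r * (Y + 1 / 2))) := by ring
    _ = _ := by
      rw [mul_assoc 4, ← Real.exp_add, ← Real.exp_add]
      ring_nf

/-! ### The initial distribution of the walk -/

lemma theta_eq_wrapGauss (hd : Odd d) {ξsq : ℝ} (hξ : 0 < ξsq) (q : ℤ) :
    wrapGauss (π * ξsq / d) d q = √(1 / (ξsq * d)) * theta (q / d) (1 / (ξsq * d)) := by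
  have hd' : (0 : ℝ) < d := by exact_mod_cast hd.pos
  rw [wrapGauss_eq (by positivity) hd.pos,
    show π / (π * ξsq / d * (d : ℝ) ^ 2) = 1 / (ξsq * d) by field_simp]

lemma walkInitial_nonneg (hd : Odd d) {ξsq : ℝ} (hξ : 0 < ξsq) (n₀ : ℤ) (p : Label d) :
    0 ≤ walkInitial d ξsq n₀ p := by
  have hd' : (0 : ℝ) < d := by exact_mod_cast hd.pos
  have h := theta_pos (s := 1 / (ξsq * d)) (by positivity)
  have h2 := overlapSum_pos hd hξ
  have h3 := h ((((p : ℤ) - n₀ : ℤ) : ℝ) / d)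
  have h4 := h ((((p : ℤ) - n₀ + 1 : ℤ) : ℝ) / d)
  unfold walkInitial
  positivity

lemma sum_walkInitial (hd : Odd d) {ξsq : ℝ} (hξ : 0 < ξsq) (n₀ : ℤ) :
    ∑ p : Label d, walkInitial d ξsq n₀ p = 1 := by
  have hd' : (0 : ℝ) < d := by exact_mod_cast hd.pos
  have h2 := overlapSum_pos hd hξ
  simp only [walkInitial, ← Finset.sum_div]
  rw [← overlapSum_eq hd hξ]
  exact div_self (by positivity)

/-- One theta factor is bounded by its value at 0, and the normalizing sum is bounded below by its
term at p ≡ n₀. The ratio left over, θ₃(1/d) in the denominator, costs e^{πξ²/d}. -/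
lemma walkInitial_le (hd : Odd d) {ξsq : ℝ} (hξ : 0 < ξsq) (n₀ : ℤ) (p : Label d) :
    walkInitial d ξsq n₀ p ≤
      Real.exp (π * ξsq / d) * wrapGauss (π * ξsq / d) d ((p : ℤ) - n₀) := by
  have hd' : (0 : ℝ) < d := by exact_mod_cast hd.pos
  have hs : 0 < 1 / (ξsq * d) := by positivity
  have hpos := theta_pos hs
  have h1 : theta (1 / d) (1 / (ξsq * d)) * theta 0 (1 / (ξsq * d)) ≤
      (d : ℝ) / 2 * overlapSum d ξsq := by
    rw [overlapSum_eq hd hξ n₀]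
    obtain ⟨l, hl⟩ := Label.ofInt_eq hd n₀
    refine le_trans (le_of_eq ?_) (Finset.single_le_sum (f := fun p : Label d =>
      theta ((((p : ℤ) - n₀ + 1 : ℤ) : ℝ) / d) (1 / (ξsq * d)) *
        theta ((((p : ℤ) - n₀ : ℤ) : ℝ) / d) (1 / (ξsq * d)))
      (fun p _ => (mul_pos (hpos _) (hpos _)).le) (Finset.mem_univ (Label.ofInt hd n₀)))
    simp only [hl]
    rw [show ((n₀ + l * d - n₀ + 1 : ℤ) : ℝ) / d = 1 / d + (l : ℝ) by push_cast; field_simp; ring,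
      show ((n₀ + l * d - n₀ : ℤ) : ℝ) / d = 0 + (l : ℝ) by push_cast; field_simp; ring,
      theta_add_int, theta_add_int]
  have h2 : Real.exp (-(π * ξsq / d)) ≤ √(1 / (ξsq * d)) * theta (1 / d) (1 / (ξsq * d)) := by
    have := theta_eq_wrapGauss hd hξ 1
    rw [Int.cast_one] at this
    rw [← this]
    refine le_trans (le_of_eq ?_) ((summable_wrap (a := π * ξsq / d) (by positivity) hd.pos
      1).le_tsum 0 fun _ _ => (Real.exp_pos _).le)
    simp
  have h3 := theta_le_theta_zero hs ((((p : ℤ) - n₀ + 1 : ℤ) : ℝ) / d)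
  have hS := overlapSum_pos hd hξ
  have h4 := hpos ((((p : ℤ) - n₀ : ℤ) : ℝ) / d)
  have h5 := hpos (1 / d)
  have h6 := hpos 0
  have hq : 0 < √(1 / (ξsq * (d : ℝ))) := Real.sqrt_pos.mpr hs
  rw [theta_eq_wrapGauss hd hξ]
  have h7 : 1 ≤ Real.exp (π * ξsq / d) * (√(1 / (ξsq * d)) * theta (1 / d) (1 / (ξsq * d))) := by
    refine le_trans (le_of_eq ?_) (mul_le_mul_of_nonneg_left h2 (Real.exp_pos _).le)
    rw [← Real.exp_add, add_neg_cancel, Real.exp_zero]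
  rw [walkInitial, div_le_iff₀ (by positivity)]
  calc _ ≤ theta 0 (1 / (ξsq * d)) * theta ((((p : ℤ) - n₀ : ℤ) : ℝ) / d) (1 / (ξsq * d)) := by
        gcongr
    _ ≤ (Real.exp (π * ξsq / d) * (√(1 / (ξsq * d)) * theta (1 / d) (1 / (ξsq * d)))) *
        (theta 0 (1 / (ξsq * d)) * theta ((((p : ℤ) - n₀ : ℤ) : ℝ) / d) (1 / (ξsq * d))) :=
        le_mul_of_one_le_left (by positivity) h7
    _ = Real.exp (π * ξsq / d) * (√(1 / (ξsq * d)) *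
        theta ((((p : ℤ) - n₀ : ℤ) : ℝ) / d) (1 / (ξsq * d))) *
        (theta (1 / d) (1 / (ξsq * d)) * theta 0 (1 / (ξsq * d))) := by ring
    _ ≤ _ := by gcongr

lemma sum_walkInitial_tail_le (hd : Odd d) {ξsq : ℝ} (hξ : 0 < ξsq) (n₀ : ℤ) {Y : ℝ}
    (hY : |(n₀ : ℝ)| ≤ Y) :
    ∑ p : Label d, walkInitial d ξsq n₀ p * (if Y < |((p : ℤ) : ℝ)| then 1 else 0) ≤
      2 * Real.exp (π * ξsq / d) * theta 0 (ξsq / d) *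
        Real.exp (-(π * ξsq / d * (Y - |(n₀ : ℝ)|) ^ 2)) := by
  have hd' : (0 : ℝ) < d := by exact_mod_cast hd.pos
  have hb : 0 < π * ξsq / d := by positivity
  have hw := fun q => (wrapGauss_pos hb hd.pos q).le
  have hθ : π * ξsq / d / π = ξsq / d := by field_simp
  set b := π * ξsq / d with hbdef
  -- This rate minimises r²/(4b) - r(Y - |n₀|) in the Chernoff bound.
  set r := 2 * b * (Y - |(n₀ : ℝ)|) with hr
  have hr0 : 0 ≤ r := mul_nonneg (by positivity) (sub_nonneg.mpr hY)
  have h := sum_wrapGauss_mul_exp_le hb hd n₀ (x := 0) (by norm_num) r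
  simp only [add_zero, hθ] at h
  have hn : Real.exp (r * n₀) + Real.exp (-r * n₀) ≤ 2 * Real.exp (r * |(n₀ : ℝ)|) := by
    have e1 : Real.exp (r * n₀) ≤ Real.exp (r * |(n₀ : ℝ)|) := by
      gcongr; exact le_abs_self _
    have e2 : Real.exp (-r * n₀) ≤ Real.exp (r * |(n₀ : ℝ)|) := by
      rw [neg_mul, ← mul_neg]
      gcongr; exact neg_le_abs _
    linarith
  have hθp := theta_pos (s := ξsq / d) (by positivity) 0
  calc _ ≤ ∑ p : Label d, Real.exp b * Real.exp (-(r * Y)) * (wrapGauss b d ((p : ℤ) - n₀) *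
        (Real.exp (r * ((p : ℤ) : ℝ)) + Real.exp (-r * ((p : ℤ) : ℝ)))) := by
        refine Finset.sum_le_sum fun p _ => ?_
        have h0 : (if Y < |((p : ℤ) : ℝ)| then (1 : ℝ) else 0) ≤ Real.exp (-(r * Y)) *
            (Real.exp (r * ((p : ℤ) : ℝ)) + Real.exp (-r * ((p : ℤ) : ℝ))) := by
          split_ifs with hp
          · rw [mul_add, ← Real.exp_add, ← Real.exp_add]
            rcases abs_cases ((p : ℤ) : ℝ) with ⟨hp1, _⟩ | ⟨hp1, _⟩
            · have : 1 ≤ Real.exp (-(r * Y) + r * ((p : ℤ) : ℝ)) :=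
                Real.one_le_exp (by rw [hp1] at hp; nlinarith)
              linarith [Real.exp_pos (-(r * Y) + -r * ((p : ℤ) : ℝ))]
            · have : 1 ≤ Real.exp (-(r * Y) + -r * ((p : ℤ) : ℝ)) :=
                Real.one_le_exp (by rw [hp1] at hp; nlinarith)
              linarith [Real.exp_pos (-(r * Y) + r * ((p : ℤ) : ℝ))]
          · positivity
        calc _ ≤ (Real.exp b * wrapGauss b d ((p : ℤ) - n₀)) * (Real.exp (-(r * Y)) *
            (Real.exp (r * ((p : ℤ) : ℝ)) + Real.exp (-r * ((p : ℤ) : ℝ)))) :=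
              mul_le_mul (walkInitial_le hd hξ n₀ p) h0 (by split_ifs <;> norm_num)
                (mul_nonneg (Real.exp_pos _).le (hw _))
          _ = _ := by ring
    _ ≤ Real.exp b * Real.exp (-(r * Y)) * (Real.exp (r ^ 2 / (4 * b)) *
        (2 * Real.exp (r * |(n₀ : ℝ)|)) * theta 0 (ξsq / d)) := by
        rw [← Finset.mul_sum]
        refine mul_le_mul_of_nonneg_left (h.trans ?_) (by positivity)
        gcongr
    _ = 2 * Real.exp b * theta 0 (ξsq / d) * (Real.exp (-(r * Y)) * Real.exp (r ^ 2 / (4 * b)) *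
        Real.exp (r * |(n₀ : ℝ)|)) := by ring
    _ = _ := by
        rw [← Real.exp_add, ← Real.exp_add]
        congr 2
        rw [hr]
        field_simp
        ring

/-- Three zones of starting points: up to Y₁ the walk bound with rate r₁; between Y₁ and Y₂ the tail
at Y₁ times the walk bound with rate r₂; beyond Y₂ the tail at Y₂ times the trivial bound 2. -/
lemma norm_backactionFactor_sub_one_le (hd : Odd d) {ξsq σsq : ℝ} (hξ : 0 < ξsq) (hσ : 0 < σsq)
    (n₀ : ℤ) {N : ℕ} {M Y₁ Y₂ r₁ r₂ : ℝ} (hN : N ≤ M) (hr₁ : 0 ≤ r₁) (hr₂ : 0 ≤ r₂)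
    (hY₁ : |(n₀ : ℝ)| ≤ Y₁) (hY : Y₁ ≤ Y₂) :
    ‖backactionFactor d ξsq σsq n₀ (fun _ => 1 / 2) N - 1‖ ≤
      4 * Real.exp (r₁ / 2) *
        Real.exp (M * (r₁ ^ 2 / (4 * (2 * π * σsq / d))) - r₁ * (d / 2 - Y₁)) +
      2 * Real.exp (π * ξsq / d) * theta 0 (ξsq / d) *
        (Real.exp (-(π * ξsq / d * (Y₁ - |(n₀ : ℝ)|) ^ 2)) * (4 * Real.exp (r₂ / 2) *
          Real.exp (M * (r₂ ^ 2 / (4 * (2 * π * σsq / d))) - r₂ * (d / 2 - Y₂))) +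
        Real.exp (-(π * ξsq / d * (Y₂ - |(n₀ : ℝ)|) ^ 2)) * 2) := by
  set A := 4 * Real.exp (r₁ / 2) *
        Real.exp (M * (r₁ ^ 2 / (4 * (2 * π * σsq / d))) - r₁ * (d / 2 - Y₁)) with hA
  set B := 4 * Real.exp (r₂ / 2) *
          Real.exp (M * (r₂ ^ 2 / (4 * (2 * π * σsq / d))) - r₂ * (d / 2 - Y₂)) with hB
  have hA0 : 0 ≤ A := by positivity
  have hB0 : 0 ≤ B := by positivity
  have e : backactionFactor d ξsq σsq n₀ (fun _ => 1 / 2) N - 1 = -∑ p : Label d,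
      (walkInitial d ξsq n₀ p : ℂ) * (1 - walkValue d σsq (1 / 2) N p) := by
    simp only [mul_sub, mul_one, Finset.sum_sub_distrib, ← Complex.ofReal_sum,
      sum_walkInitial hd hξ]
    rw [← backactionFactor_eq]
    push_cast
    ring
  rw [e, norm_neg]
  calc _ ≤ ∑ p : Label d, (walkInitial d ξsq n₀ p * A +
        walkInitial d ξsq n₀ p * (if Y₁ < |((p : ℤ) : ℝ)| then 1 else 0) * B +
        walkInitial d ξsq n₀ p * (if Y₂ < |((p : ℤ) : ℝ)| then 1 else 0) * 2) := by
        refine norm_sum_le_of_le _ fun p _ => ?_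
        rw [norm_mul, Complex.norm_real, Real.norm_of_nonneg (walkInitial_nonneg hd hξ _ _),
          mul_assoc, mul_assoc, ← mul_add, ← mul_add]
        refine mul_le_mul_of_nonneg_left ?_ (walkInitial_nonneg hd hξ _ _)
        by_cases h2 : Y₂ < |((p : ℤ) : ℝ)|
        · have := norm_walkValue_le_one hd hσ N p
          have h3 := norm_sub_le (1 : ℂ) (walkValue d σsq (1 / 2) N p)
          rw [norm_one] at h3
          rw [if_pos h2, if_pos (hY.trans_lt h2)]
          linarith
        · by_cases h1 : Y₁ < |((p : ℤ) : ℝ)|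
          · have := norm_one_sub_walkValue_le_of_abs_le hd hσ hr₂ hN (not_lt.mp h2)
            rw [if_neg h2, if_pos h1]
            linarith
          · have := norm_one_sub_walkValue_le_of_abs_le hd hσ hr₁ hN (not_lt.mp h1)
            rw [if_neg h2, if_neg h1]
            linarith
    _ ≤ _ := by
        have t1 := sum_walkInitial_tail_le hd hξ n₀ hY₁
        have t2 := sum_walkInitial_tail_le hd hξ n₀ (hY₁.trans hY)
        simp only [Finset.sum_add_distrib, ← Finset.sum_mul, sum_walkInitial hd hξ]
        have t3 := mul_le_mul_of_nonneg_right t1 hB0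
        linarith

end Backaction

section Asymptotics

variable {d : ℕ}

/-! ### Asymptotics of the three factors -/

lemma exists_sq_mul_exp_neg_rpow_le {κ η : ℝ} (hκ : 0 < κ) (hη : 0 < η) :
    ∃ K : ℝ, 0 ≤ K ∧ ∀ x : ℝ, 1 ≤ x → x ^ 2 * Real.exp (-(κ * x ^ η)) ≤ K := by
  -- The exponential dominates its n-th Taylor term, and ηn > 2.
  obtain ⟨n, hn⟩ := exists_nat_gt (2 / η)
  refine ⟨n.factorial / κ ^ n, by positivity, fun x hx => ?_⟩
  have hx0 : 0 < x := by linarith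
  have h1 := Real.pow_div_factorial_le_exp (κ * x ^ η) (by positivity) n
  have h2 : x ^ 2 ≤ (x ^ η) ^ n := by
    rw [← Real.rpow_natCast, ← Real.rpow_natCast, ← Real.rpow_mul hx0.le]
    refine Real.rpow_le_rpow_of_exponent_le hx ?_
    rw [div_lt_iff₀ hη] at hn
    push_cast
    linarith
  rw [Real.exp_neg, ← div_eq_mul_inv, div_le_div_iff₀ (Real.exp_pos _) (by positivity)]
  rw [div_le_iff₀ (by positivity), mul_pow] at h1
  calc x ^ 2 * κ ^ n ≤ (x ^ η) ^ n * κ ^ n := by gcongr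
    _ ≤ _ := by linarith

/-- As s = c x^{α-1} may tend to 0, duality is used: θ₃(0, is) = s^{-1/2} θ₃(0, i/s), where s ≥ c/x²
bounds the first factor and s ≤ c the second. -/
lemma exists_theta_zero_le {c α : ℝ} (hc : 0 < c) (hα : -1 < α) (hα' : α < 1) :
    ∃ K : ℝ, 0 ≤ K ∧ ∀ x : ℝ, 1 ≤ x → theta 0 (c * x ^ α / x) ≤ K * x := by
  refine ⟨theta 0 (1 / c) / √c, ?_, fun x hx => ?_⟩
  · have := theta_pos (s := 1 / c) (by positivity) 0
    positivity
  have hx0 : 0 < x := by linarith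
  set s := c * x ^ α / x with hs
  have hs0 : 0 < s := by positivity
  have h1 : x ^ α ≤ x := by
    simpa using Real.rpow_le_rpow_of_exponent_le hx hα'.le
  have h2 : 1 ≤ x ^ α * x := by
    have := Real.one_le_rpow hx (show 0 ≤ α + 1 by linarith)
    rwa [Real.rpow_add hx0, Real.rpow_one] at this
  have h3 := sqrt_mul_theta_zero (a := π * s) (by positivity)
  rw [show π / (π * s) = 1 / s by field_simp, show π * s / π = s by field_simp] at h3
  rw [← h3]
  have h4 : theta 0 (1 / s) ≤ theta 0 (1 / c) := by
    refine theta_zero_antitone (by positivity) (one_div_le_one_div_of_le hs0 ?_)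
    rw [hs, div_le_iff₀ hx0]
    gcongr
  have h5 : √(1 / s) ≤ x / √c := by
    rw [Real.sqrt_le_left (by positivity), div_pow, Real.sq_sqrt hc.le, hs, one_div_div,
      div_le_div_iff₀ (by positivity) hc]
    nlinarith [mul_pos hx0 hc]
  calc _ ≤ x / √c * theta 0 (1 / c) :=
        mul_le_mul h5 h4 (theta_pos (by positivity) _).le (by positivity)
    _ = _ := by ring

/-- The rate is optimal for a walk of t√d steps over the distance (1-γ)d/2 from γd/2 to the edge.
Half of it is optimal for half that distance, from (1+γ)d/4, and gives a quarter of the exponent. -/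
lemma walk_exponent_eq {c β γ t x : ℝ} (hx : 0 < x) (hc : 0 < c) (ht : 0 < t) :
    t * √x * ((2 * π * c * (1 - γ) / t * x ^ (β - 1 / 2)) ^ 2 / (4 * (2 * π * (c * x ^ β) / x))) -
        2 * π * c * (1 - γ) / t * x ^ (β - 1 / 2) * (x / 2 - γ * (x / 2)) =
      -(π * c * (1 - γ) ^ 2 / (2 * t) * x ^ (1 / 2 + β)) ∧
    t * √x * ((2 * π * c * (1 - γ) / t * x ^ (β - 1 / 2) / 2) ^ 2 /
        (4 * (2 * π * (c * x ^ β) / x))) -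
        2 * π * c * (1 - γ) / t * x ^ (β - 1 / 2) / 2 * (x / 2 - (1 + γ) * x / 4) =
      -(π * c * (1 - γ) ^ 2 / (2 * t) / 4 * x ^ (1 / 2 + β)) := by
  have hw : 0 < x ^ β := by positivity
  have hu0 : 0 < √x := Real.sqrt_pos.mpr hx
  have hu' : x ^ (1 / 2 : ℝ) = √x := (Real.sqrt_eq_rpow x).symm
  rw [Real.rpow_add hx, Real.rpow_sub hx, hu']
  generalize x ^ β = w at *
  have hxu : x = √x ^ 2 := (Real.sq_sqrt hx.le).symm
  generalize √x = u at *
  subst hxu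
  constructor
  · field_simp
    ring
  · field_simp
    ring

lemma tail_exponent_eq {c α γ x : ℝ} (hx : 0 < x) (n : ℝ) :
    π * (c * x ^ α) / x * (γ * (x / 2) - n) ^ 2 =
      π * c * (γ - 2 * n / x) ^ 2 / 4 * x ^ (1 + α) := by
  rw [Real.rpow_add hx, Real.rpow_one]
  generalize x ^ α = v
  field_simp
  ring

/-- By (A+B)² ≥ A² + B², moving the cut from γd/2 to (1+γ)d/4 gains a Gaussian factor that does not
depend on n₀. -/
lemma tail_exponent_add_le {c α γ x n : ℝ} (hx : 0 < x) (hc : 0 < c) (hγ : γ ≤ 1)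
    (hn : n ≤ γ * (x / 2)) :
    π * c * (γ - 2 * n / x) ^ 2 / 4 * x ^ (1 + α) + π * c * (1 - γ) ^ 2 / 16 * x ^ (1 + α) ≤
      π * (c * x ^ α) / x * ((1 + γ) * x / 4 - n) ^ 2 := by
  have h1 : π * c * (1 - γ) ^ 2 / 16 * x ^ (1 + α) =
      π * (c * x ^ α) / x * ((1 - γ) * x / 4) ^ 2 := by
    rw [Real.rpow_add hx, Real.rpow_one]
    field_simp
    norm_num
  have h2 : ∀ A B : ℝ, 0 ≤ A → 0 ≤ B → A ^ 2 + B ^ 2 ≤ (A + B) ^ 2 := fun A B hA hB => by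
    nlinarith [mul_nonneg hA hB]
  have h3 : 0 ≤ 1 - γ := sub_nonneg.mpr hγ
  rw [← tail_exponent_eq hx, h1, ← mul_add,
    show (1 + γ) * x / 4 - n = (γ * (x / 2) - n) + (1 - γ) * x / 4 by ring]
  exact mul_le_mul_of_nonneg_left (h2 _ _ (sub_nonneg.mpr hn) (by positivity)) (by positivity)

lemma exists_norm_backactionFactor_sub_one_le {c₁ c₂ α β γ t : ℝ} (hc₁ : 0 < c₁) (hc₂ : 0 < c₂)
    (hα : -1 < α) (hα' : α < 1) (hβ : -(1 / 2) < β) (hβ' : β < 0)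
    (hγ' : γ < 1) (ht : 0 < t) :
    ∃ K : ℝ, ∀ d : ℕ, Odd d → ∀ n₀ : ℤ, |(n₀ : ℝ)| ≤ γ * (d / 2) → ∀ N : ℕ, N ≤ t * √d →
      ‖backactionFactor d (c₁ * (d : ℝ) ^ α) (c₂ * (d : ℝ) ^ β) n₀ (fun _ => 1 / 2) N - 1‖ ≤
        K * backactionError c₁ c₂ α β γ t n₀ d := by
  have hγ1 : 0 < 1 - γ := by linarith
  obtain ⟨K₀, hK₀, hθ⟩ := exists_theta_zero_le hc₁ hα hα'
  set κ := π * c₂ * (1 - γ) ^ 2 / (2 * t) with hκ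
  have hκ0 : 0 < κ := by positivity
  -- The tail prefactor is O(d) while E_d has d⁻¹, so the surplus exponentials of the middle and
  -- outer zones must each absorb d².
  obtain ⟨K₁, hK₁, h₁⟩ := exists_sq_mul_exp_neg_rpow_le (κ := κ / 4) (η := 1 / 2 + β)
    (by positivity) (by linarith)
  obtain ⟨K₂, hK₂, h₂⟩ := exists_sq_mul_exp_neg_rpow_le (κ := π * c₁ * (1 - γ) ^ 2 / 16)
    (η := 1 + α) (by positivity) (by linarith)
  set R := 2 * π * c₂ * (1 - γ) / t with hR
  have hR0 : 0 < R := by positivity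
  set A := 4 * Real.exp (R / 2) with hA
  set B := 2 * Real.exp (π * c₁) * K₀ * (A * K₁ + 2 * K₂) with hB
  have hA0 : 0 ≤ A := by positivity
  have hB0 : 0 ≤ B := by positivity
  refine ⟨A + B, fun d hd n₀ hn₀ N hN => ?_⟩
  have hx : (1 : ℝ) ≤ d := by exact_mod_cast hd.pos
  specialize hθ d hx
  specialize h₁ d hx
  specialize h₂ d hx
  have hx0 : (0 : ℝ) < d := by linarith
  have hd2 := hd
  simp only [backactionError]
  set x : ℝ := (d : ℝ) with hxdef
  have hw : 0 < x ^ β := by positivity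
  have hv : 0 < x ^ α := by positivity
  have hvx : x ^ α ≤ x := by simpa using Real.rpow_le_rpow_of_exponent_le hx hα'.le
  set r := R * x ^ (β - 1 / 2) with hr
  have hr0 : 0 ≤ r := by positivity
  have hrR : r ≤ R := mul_le_of_le_one_right hR0.le
    (Real.rpow_le_one_of_one_le_of_nonpos hx (by linarith))
  have hY : γ * (x / 2) ≤ (1 + γ) * x / 4 := by
    have := mul_le_mul_of_nonneg_right hγ'.le hx0.le
    linarith
  have key := norm_backactionFactor_sub_one_le hd2 (ξsq := c₁ * x ^ α) (σsq := c₂ * x ^ β)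
    (by positivity) (by positivity) n₀ hN hr0 (by positivity : 0 ≤ r / 2) hn₀ hY
  have F := walk_exponent_eq (c := c₂) (β := β) (γ := γ) (t := t) hx0 hc₂ ht
  have F3 := tail_exponent_eq (c := c₁) (α := α) (γ := γ) hx0 |(n₀ : ℝ)|
  have F4 := tail_exponent_add_le (c := c₁) (α := α) (γ := γ) hx0 hc₁ hγ'.le hn₀
  rw [← hR, ← hκ] at F
  rw [F.1, F.2, F3] at key
  set X₁ := κ * x ^ (1 / 2 + β) with hX₁
  set X₂ := π * c₁ * (γ - 2 * |(n₀ : ℝ)| / x) ^ 2 / 4 * x ^ (1 + α) with hX₂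
  have F5 : Real.exp (π * (c₁ * x ^ α) / x) ≤ Real.exp (π * c₁) := by
    rw [Real.exp_le_exp, div_le_iff₀ hx0, ← mul_assoc]
    gcongr
  have F6 : Real.exp (-(π * (c₁ * x ^ α) / x * ((1 + γ) * x / 4 - |(n₀ : ℝ)|) ^ 2)) ≤
      Real.exp (-X₂) * Real.exp (-(π * c₁ * (1 - γ) ^ 2 / 16 * x ^ (1 + α))) := by
    rw [← Real.exp_add, Real.exp_le_exp]; linarith
  have G1 : x * Real.exp (-(κ / 4 * x ^ (1 / 2 + β))) ≤ K₁ * x⁻¹ := by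
    rw [← div_eq_mul_inv, le_div_iff₀ hx0]; linarith
  have G2 : x * Real.exp (-(π * c₁ * (1 - γ) ^ 2 / 16 * x ^ (1 + α))) ≤ K₂ * x⁻¹ := by
    rw [← div_eq_mul_inv, le_div_iff₀ hx0]; linarith
  have G3 : Real.exp (r / 2) ≤ Real.exp (R / 2) := by gcongr
  have G4 : Real.exp (r / 2 / 2) ≤ Real.exp (R / 2) := by rw [Real.exp_le_exp]; linarith
  have G5 : 1 ≤ x ^ (β / 2 + 1 / 2) := Real.one_le_rpow hx (by linarith)
  have hθ0 := (theta_pos (s := c₁ * x ^ α / x) (by positivity) 0).le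
  rw [neg_mul, neg_mul, ← hX₂, Real.rpow_neg_one]
  refine key.trans ?_
  calc _ ≤ A * Real.exp (-X₁) + 2 * Real.exp (π * c₁) * (K₀ * x) *
        (Real.exp (-X₂) * (A * Real.exp (-(κ / 4 * x ^ (1 / 2 + β)))) +
        Real.exp (-X₂) * Real.exp (-(π * c₁ * (1 - γ) ^ 2 / 16 * x ^ (1 + α))) * 2) := by
        rw [hA]; gcongr
    _ = A * Real.exp (-X₁) + 2 * Real.exp (π * c₁) * K₀ * Real.exp (-X₂) *
        (A * (x * Real.exp (-(κ / 4 * x ^ (1 / 2 + β)))) +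
        2 * (x * Real.exp (-(π * c₁ * (1 - γ) ^ 2 / 16 * x ^ (1 + α))))) := by ring
    _ ≤ A * Real.exp (-X₁) + 2 * Real.exp (π * c₁) * K₀ * Real.exp (-X₂) *
        (A * (K₁ * x⁻¹) + 2 * (K₂ * x⁻¹)) := by gcongr
    _ = A * (1 * Real.exp (-X₁)) + B * (x⁻¹ * Real.exp (-X₂)) := by rw [hB]; ring
    _ ≤ A * (x ^ (β / 2 + 1 / 2) * Real.exp (-X₁)) + B * (x⁻¹ * Real.exp (-X₂)) := by gcongr
    _ ≤ _ := by
        have q1 : 0 ≤ x ^ (β / 2 + 1 / 2) * Real.exp (-X₁) := by positivity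
        have q2 : 0 ≤ x⁻¹ * Real.exp (-X₂) := by positivity
        rw [add_mul, mul_add, mul_add]
        linarith [mul_nonneg hA0 q2, mul_nonneg hB0 q1]

/-- After Poisson summation the term m = 0 dominates. For m ≠ 0 and |z| ≤ 1/2 one has |m + z| ≥
|m|/2, which compares the rest with a centred series of a quarter of the rate. -/
lemma gauss_shift_bounds {a : ℝ} (ha : 0 < a) {z : ℝ} (hz : |z| ≤ 1 / 2) :
    Real.exp (-(a * z ^ 2)) ≤ √(π / a) * theta z (π / a) ∧
      √(π / a) * theta z (π / a) ≤
        Real.exp (-(a * z ^ 2)) + (theta 0 (a / (4 * π)) - 1) := by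
  have h := hasSum_gauss ha z
  have h0 := hasSum_gauss_zero (a := a / 4) (by positivity)
  rw [show a / 4 / π = a / (4 * π) by field_simp] at h0
  constructor
  · rw [← h.tsum_eq]
    refine le_trans (le_of_eq ?_) (h.summable.le_tsum 0 fun _ _ => (Real.exp_pos _).le)
    simp
  · have h1 := (h0.sub (hasSum_ite_eq (0 : ℤ) (1 : ℝ))).add
      (hasSum_ite_eq (0 : ℤ) (Real.exp (-(a * z ^ 2))))
    rw [add_comm (Real.exp (-(a * z ^ 2)))]
    refine hasSum_le (fun m => ?_) h h1
    by_cases hm : m = 0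
    · simp [hm]
    · simp only [hm, if_false, sub_zero, add_zero]
      rw [Real.exp_le_exp, neg_le_neg_iff, div_mul_eq_mul_div, mul_div_assoc]
      refine mul_le_mul_of_nonneg_left ?_ ha.le
      have h3 : (1 : ℝ) ≤ |(m : ℝ)| := by exact_mod_cast Int.one_le_abs hm
      have h4 : |(m : ℝ)| / 2 ≤ |(m : ℝ) + z| := by
        have := abs_sub_abs_le_abs_sub (m : ℝ) (-z)
        rw [abs_neg, sub_neg_eq_add] at this
        linarith
      have h5 : (|(m : ℝ)| / 2) ^ 2 ≤ |(m : ℝ) + z| ^ 2 := by gcongr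
      rw [div_pow, sq_abs, sq_abs] at h5
      linarith

/-- Multiplying numerator and denominator by √A, with A = 1/(2ξ²d), puts the first theta factors in
Gaussian form. The main term comes from the shift 1/(2d), as 2πξ²d/(2d)² = πξ²/(2d). -/
lemma abs_waveFactor_sub_le (hd : Odd d) {ξsq : ℝ} (hξ : 0 < ξsq) {h h' m : ℝ}
    (hh : theta 0 (ξsq * d / 2) - 1 ≤ h) (hh' : theta 0 (d / (2 * ξsq)) - 1 ≤ h')
    (hm : Real.exp (-(2 * π * ξsq * d * (1 / 2 - 1 / (2 * d)) ^ 2)) ≤ m) :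
    |waveFactor d ξsq - Real.exp (-(π * ξsq / (2 * d)))| ≤
      2 * ((h + h' + h * h') + (m + h) * (1 + h')) := by
  have hx0 : (0 : ℝ) < d := by exact_mod_cast hd.pos
  have hx : (1 : ℝ) ≤ d := by exact_mod_cast hd.pos
  have hd1 : 1 / (2 * (d : ℝ)) ≤ 1 / 2 := by
    rw [div_le_div_iff₀ (by positivity) (by positivity)]; linarith
  have hd0 : 0 < 1 / (2 * (d : ℝ)) := by positivity
  set a := 2 * π * ξsq * d with ha
  have ha0 : 0 < a := by positivity
  set A := 1 / (2 * ξsq * d) with hA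
  have hA0 : 0 < A := by positivity
  have hπa : π / a = A := by rw [ha, hA]; field_simp
  have haπ : a / (4 * π) = ξsq * d / 2 := by rw [ha]; field_simp; norm_num
  have hb : ∀ z : ℝ, |z| ≤ 1 / 2 → Real.exp (-(a * z ^ 2)) ≤ √A * theta z A ∧
      √A * theta z A ≤ Real.exp (-(a * z ^ 2)) + h := fun z hz => by
    obtain ⟨h1, h2⟩ := gauss_shift_bounds ha0 hz
    rw [hπa] at h1 h2
    rw [haπ] at h2
    exact ⟨h1, by linarith⟩
  have hq : 0 < √A := Real.sqrt_pos.mpr hA0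
  obtain ⟨a1, a2⟩ := hb (1 / (2 * d)) (by rw [abs_of_pos hd0]; exact hd1)
  obtain ⟨b1, b2⟩ := hb (1 / 2 - 1 / (2 * d)) (by rw [abs_of_nonneg (by linarith)]; linarith)
  obtain ⟨c1, c2⟩ := hb 0 (by norm_num)
  obtain ⟨d1, d2⟩ := hb (1 / 2) (by rw [abs_of_pos (by norm_num)])
  have hB0 : 0 < d / (2 * ξsq) := by positivity
  have f1 := abs_le.mp ((abs_theta_sub_one_le hB0 (1 / 2)).trans hh')
  have f2 := one_le_theta_zero hB0
  have f3 := theta_pos hB0 (1 / 2)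
  have f4 := theta_le_theta_zero hB0 (1 / 2)
  have e0 : a * (1 / (2 * d)) ^ 2 = π * ξsq / (2 * d) := by rw [ha]; field_simp
  have e1 : Real.exp (-(a * (1 / 2) ^ 2)) ≤ m := by
    refine le_trans ?_ hm
    rw [Real.exp_le_exp, neg_le_neg_iff]
    refine mul_le_mul_of_nonneg_left ?_ ha0.le
    refine pow_le_pow_left₀ (by linarith) (by linarith) 2
  have e2 : Real.exp (-(a * (0 : ℝ) ^ 2)) = 1 := by simp
  have e3 : Real.exp (-(π * ξsq / (2 * d))) ≤ 1 :=
    Real.exp_le_one_iff.mpr (by rw [neg_nonpos]; positivity)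
  have e4 := Real.exp_pos (-(π * ξsq / (2 * d)))
  rw [e0] at a1 a2
  rw [e2] at c1 c2
  have p0 : 0 ≤ h := (sub_nonneg.mpr (one_le_theta_zero (by positivity))).trans hh
  have p1 : 0 ≤ h' := by linarith
  have p2 : 0 ≤ m := (Real.exp_pos _).le.trans hm
  have b3 := (Real.exp_pos (-(a * (1 / 2 - 1 / (2 * (d : ℝ))) ^ 2))).le.trans b1
  have d3 := (Real.exp_pos (-(a * (1 / 2 : ℝ) ^ 2))).le.trans d1
  have hwf : waveFactor d ξsq =
      ((√A * theta (1 / (2 * d)) A) * theta (1 / 2) (d / (2 * ξsq)) +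
        (√A * theta (1 / 2 - 1 / (2 * d)) A) * theta 0 (d / (2 * ξsq))) /
      ((√A * theta 0 A) * theta 0 (d / (2 * ξsq)) +
        (√A * theta (1 / 2) A) * theta (1 / 2) (d / (2 * ξsq))) := by
    rw [waveFactor, overlapSum, ← hA]
    simp only [mul_assoc, ← mul_add]
    rw [mul_div_mul_left _ _ hq.ne']
  rw [hwf]
  -- To leading order P ≈ e, S, U, V ≈ 1 and Q, T ≈ 0; the rest is algebra with these six numbers.
  generalize √A * theta (1 / (2 * d)) A = P at *
  generalize √A * theta (1 / 2 - 1 / (2 * d)) A = Q at *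
  generalize √A * theta 0 A = S at *
  generalize √A * theta (1 / 2) A = T at *
  generalize theta 0 (d / (2 * ξsq)) = U at *
  generalize theta (1 / 2) (d / (2 * ξsq)) = V at *
  generalize Real.exp (-(π * ξsq / (2 * d))) = e at *
  have hQ : Q * U ≤ (m + h) * (1 + h') :=
    mul_le_mul (by linarith) (by linarith) (by linarith) (by linarith)
  have hQ0 : 0 ≤ Q * U := mul_nonneg b3 (by linarith)
  have hT : T * V ≤ (m + h) * (1 + h') :=
    mul_le_mul (by linarith) (by linarith) (by linarith) (by linarith)
  have hT0 : 0 ≤ T * V := mul_nonneg d3 (by linarith)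
  have hSU : S * U ≤ (1 + h) * (1 + h') :=
    mul_le_mul c2 (by linarith) (by linarith) (by linarith)
  have hSU1 : 1 ≤ S * U := one_le_mul_of_one_le_of_one_le c1 f2
  have hPV : P * V ≤ (e + h) * (1 + h') :=
    mul_le_mul a2 (by linarith) (by linarith) (by linarith)
  have hPV1 : e - h' ≤ P * V := by
    have v1 : e * V ≤ P * V := mul_le_mul_of_nonneg_right a1 f3.le
    have v2 : e * (1 - h') ≤ e * V := mul_le_mul_of_nonneg_left (by linarith) e4.le
    have v3 : e * h' ≤ h' := mul_le_of_le_one_left p1 e3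
    linarith
  set D := S * U + T * V with hD
  have hD1 : 1 ≤ D := by linarith
  have hD2 : D ≤ 1 + (h + h' + h * h') + (m + h) * (1 + h') := by rw [hD]; linarith
  have hhh : 0 ≤ h * h' := by positivity
  have heh : e * h' ≤ h' := mul_le_of_le_one_left p1 e3
  have hN : |P * V + Q * U - e * D| ≤ 2 * ((h + h' + h * h') + (m + h) * (1 + h')) := by
    have w1 : e ≤ e * D := le_mul_of_one_le_right e4.le hD1
    have w2 : e * (D - 1) ≤ D - 1 := mul_le_of_le_one_left (by linarith) e3
    have w3 : 0 ≤ (m + h) * (1 + h') := by positivity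
    exact abs_le.mpr ⟨by linarith, by linarith⟩
  have : (P * V + Q * U) / D - e = (P * V + Q * U - e * D) / D := by
    field_simp
  rw [this, abs_div, abs_of_pos (by linarith : 0 < D)]
  exact (div_le_self (abs_nonneg _) hD1).trans hN

/-- Since m² + (m-1)² = 2(m - 1/2)² + 1/2, the constant gives the leading exponential, and Poisson
summation turns the half-integer Gaussian sum into a ratio close to 1. -/
lemma imprecisionFactor_eq (hd : Odd d) {σsq : ℝ} (hσ : 0 < σsq) :
    imprecisionFactor d σsq = ((Real.exp (-(π * σsq / (2 * d))) *
      (theta (1 / 2) (d / (2 * σsq)) / theta 0 (d / (2 * σsq))) : ℝ) : ℂ) := by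
  have hd' : (0 : ℝ) < d := by exact_mod_cast hd.pos
  rw [← tsum_krausProd_one hd hσ]
  congr 1
  have h := hasSum_gauss (a := 2 * π * (σsq / d)) (by positivity) (-(1 / 2))
  have h0 := sqrt_mul_theta_zero (a := 2 * π * (σsq / d)) (by positivity)
  rw [show 2 * π * (σsq / d) / π = 2 * σsq / d by field_simp] at h0
  have e : π / (2 * π * (σsq / d)) = d / (2 * σsq) := by field_simp
  rw [e] at h h0
  have hq : √(d / (2 * σsq)) ≠ 0 := (Real.sqrt_pos.mpr (by positivity)).ne'
  have e2 : ∀ m : ℤ, krausProd d σsq 1 m = Real.exp (-(π * σsq / (2 * d))) *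
      Real.exp (-(2 * π * (σsq / d) * ((m : ℝ) + -(1 / 2)) ^ 2)) / theta 0 (2 * σsq / d) :=
    fun m => by
      rw [krausProd, ← Real.exp_add, ← Real.exp_add]
      congr 2
      push_cast
      field_simp
      ring
  simp only [e2]
  rw [tsum_div_const, tsum_mul_left, h.tsum_eq, ← h0, theta_neg, mul_div_assoc,
    mul_div_mul_left _ _ hq]

lemma abs_theta_half_div_sub_one_le {u : ℝ} (hu : 0 < u) :
    |theta (1 / 2) u / theta 0 u - 1| ≤ 2 * (theta 0 u - 1) := by
  have h1 := one_le_theta_zero hu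
  have h2 := abs_le.mp (abs_theta_sub_one_le hu (1 / 2))
  rw [div_sub_one (by linarith), abs_div, abs_of_pos (by linarith : 0 < theta 0 u)]
  refine (div_le_self (abs_nonneg _) h1).trans ?_
  rw [abs_le]
  constructor <;> linarith

end Asymptotics

/-! ### Relative errors of C₁ and C₂, and the assembly of the factors -/

section Main

lemma exists_waveFactor_eq {c α : ℝ} (hc : 0 < c) (hα : -1 < α) (hα' : α < 1) :
    ∃ K : ℝ, 0 ≤ K ∧ ∀ d : ℕ, Odd d → 4 ≤ d → ∃ ε : ℝ,
      |ε| ≤ K * ((d : ℝ)⁻¹ * Real.exp (-(π * c / 4 * (d : ℝ) ^ (1 + α))) +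
        Real.exp (-(π / (2 * c) * (d : ℝ) ^ (1 - α)))) ∧
      waveFactor d (c * (d : ℝ) ^ α) =
        Real.exp (-(π * c / 2 * (d : ℝ) ^ (α - 1))) * (1 + ε) := by
  obtain ⟨K₂, hK₂, h₂⟩ := exists_sq_mul_exp_neg_rpow_le (κ := π * c / 32) (η := 1 + α)
    (by positivity) (by linarith)
  set k := 2 / (1 - Real.exp (-(π * (c / 2)))) with hk
  set k' := 2 / (1 - Real.exp (-(π * (1 / (2 * c))))) with hk'
  have aux : ∀ y : ℝ, 0 < y → 0 ≤ 2 / (1 - Real.exp (-(π * y))) := fun y hy => by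
    have : Real.exp (-(π * y)) < 1 := Real.exp_lt_one_iff.mpr (by
      rw [neg_lt_zero]; positivity)
    exact div_nonneg zero_le_two (by linarith)
  have hk0 : 0 ≤ k := aux _ (by positivity)
  have hk0' : 0 ≤ k' := aux _ (by positivity)
  set E := Real.exp (π * c / 2) with hE
  refine ⟨E * (2 * (((k + k' + k * k') + (1 + k) * (1 + k')) * (K₂ + 1))), by positivity,
    fun d hd hd4 => ?_⟩
  have hx4 : (4 : ℝ) ≤ d := by exact_mod_cast hd4
  have hx1 : (1 : ℝ) ≤ d := by linarith
  have hx0 : (0 : ℝ) < d := by linarith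
  specialize h₂ d hx1
  have e1 : c * (d : ℝ) ^ α * d / 2 = c / 2 * (d : ℝ) ^ (1 + α) := by
    rw [Real.rpow_add hx0, Real.rpow_one]; ring
  have e2 : d / (2 * (c * (d : ℝ) ^ α)) = 1 / (2 * c) * (d : ℝ) ^ (1 - α) := by
    rw [Real.rpow_sub hx0, Real.rpow_one]; field_simp
  have e3 : π * (c * (d : ℝ) ^ α) / (2 * d) = π * c / 2 * (d : ℝ) ^ (α - 1) := by
    rw [Real.rpow_sub hx0, Real.rpow_one]; field_simp
  have hy : 1 ≤ (d : ℝ) ^ (1 + α) := Real.one_le_rpow hx1 (by linarith)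
  have hy' : 1 ≤ (d : ℝ) ^ (1 - α) := Real.one_le_rpow hx1 (by linarith)
  have hw : (d : ℝ) ^ (α - 1) ≤ 1 := Real.rpow_le_one_of_one_le_of_nonpos hx1 (by linarith)
  set y := (d : ℝ) ^ (1 + α) with hydef
  set y' := (d : ℝ) ^ (1 - α) with hydef'
  -- For d ≥ 4 one has 1/2 - 1/(2d) ≥ 3/8, and 2·(3/8)² = 9/32. The excess of 9/32 over 1/4 later
  -- pays for the factor d⁻¹.
  set m := Real.exp (-(9 / 32 * π * c * y)) with hm
  have hh : theta 0 (c * (d : ℝ) ^ α * d / 2) - 1 ≤ k * m := by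
    rw [e1]
    refine (theta_zero_sub_one_le (s₀ := c / 2) (by positivity)
      (le_mul_of_one_le_right (by positivity) hy)).trans ?_
    refine mul_le_mul_of_nonneg_left ?_ hk0
    rw [hm, Real.exp_le_exp, neg_le_neg_iff]
    have : 0 ≤ π * c * y := by positivity
    linarith
  have hh' : theta 0 (d / (2 * (c * (d : ℝ) ^ α))) - 1 ≤
      k' * Real.exp (-(π / (2 * c) * y')) := by
    rw [e2]
    refine (theta_zero_sub_one_le (s₀ := 1 / (2 * c)) (by positivity)
      (le_mul_of_one_le_right (by positivity) hy')).trans (le_of_eq ?_)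
    rw [hk', ← mul_assoc π, mul_one_div π (2 * c)]
  have hmm : Real.exp (-(2 * π * (c * (d : ℝ) ^ α) * d * (1 / 2 - 1 / (2 * d)) ^ 2)) ≤ m := by
    rw [hm, Real.exp_le_exp, neg_le_neg_iff]
    have h1 : 1 / (2 * (d : ℝ)) ≤ 1 / 8 := one_div_le_one_div_of_le (by norm_num) (by linarith)
    have h2 : (3 / 8 : ℝ) ^ 2 ≤ (1 / 2 - 1 / (2 * d)) ^ 2 := by
      refine pow_le_pow_left₀ (by norm_num) (by linarith) 2
    have h3 : 2 * π * (c * (d : ℝ) ^ α) * d = 2 * π * c * y := by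
      rw [hydef, Real.rpow_add hx0, Real.rpow_one]; ring
    rw [h3]
    calc 9 / 32 * π * c * y = 2 * π * c * y * (3 / 8) ^ 2 := by ring
      _ ≤ _ := by gcongr
  have key := abs_waveFactor_sub_le hd (ξsq := c * (d : ℝ) ^ α) (by positivity) hh hh' hmm
  rw [e3] at key
  set w := Real.exp (-(π * c / 2 * (d : ℝ) ^ (α - 1))) with hwdef
  have hw0 : 0 < w := Real.exp_pos _
  have hwE : 1 / w ≤ E := by
    rw [hwdef, one_div, ← Real.exp_neg, neg_neg, hE, Real.exp_le_exp]
    exact mul_le_of_le_one_right (by positivity) hw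
  refine ⟨waveFactor d (c * (d : ℝ) ^ α) / w - 1, ?_, by field_simp; ring⟩
  rw [div_sub_one hw0.ne', abs_div, abs_of_pos hw0, div_eq_mul_one_div, mul_comm, mul_assoc E]
  refine mul_le_mul hwE (key.trans ?_) (abs_nonneg _) (by positivity)
  set n := Real.exp (-(π / (2 * c) * y')) with hn
  have hm0 : 0 < m := Real.exp_pos _
  have hm1 : m ≤ 1 := Real.exp_le_one_iff.mpr (by rw [neg_nonpos]; positivity)
  have hn0 : 0 < n := Real.exp_pos _
  have hn1 : n ≤ 1 := Real.exp_le_one_iff.mpr (by rw [neg_nonpos]; positivity)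
  have hmK : m ≤ K₂ * ((d : ℝ)⁻¹ * Real.exp (-(π * c / 4 * y))) := by
    have s1 : m = Real.exp (-(π * c / 32 * y)) * Real.exp (-(π * c / 4 * y)) := by
      rw [hm, ← Real.exp_add]; ring_nf
    have s2 : Real.exp (-(π * c / 32 * y)) ≤ K₂ * (d : ℝ)⁻¹ := by
      rw [← div_eq_mul_inv, le_div_iff₀ hx0]
      refine le_trans ?_ h₂
      rw [mul_comm]
      refine mul_le_mul_of_nonneg_right ?_ (Real.exp_pos _).le
      exact le_self_pow₀ hx1 two_ne_zero
    rw [s1, ← mul_assoc]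
    exact mul_le_mul_of_nonneg_right s2 (Real.exp_pos _).le
  set q := (d : ℝ)⁻¹ * Real.exp (-(π * c / 4 * y)) with hq
  have hq0 : 0 ≤ q := by positivity
  have hmn : m * n ≤ m := mul_le_of_le_one_right hm0.le hn1
  calc 2 * ((k * m + k' * n + k * m * (k' * n)) + (m + k * m) * (1 + k' * n))
      ≤ 2 * ((k * (m + n) + k' * (m + n) + k * k' * (m + n)) + (m + n) * (1 + k) * (1 + k')) := by
        have t1 : k * m ≤ k * (m + n) := by gcongr; linarith
        have t2 : k' * n ≤ k' * (m + n) := by gcongr; linarith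
        have t3 : k * m * (k' * n) ≤ k * k' * (m + n) := by
          calc k * m * (k' * n) = k * k' * (m * n) := by ring
            _ ≤ k * k' * (m + n) := by gcongr; linarith
        have t4 : (m + k * m) * (1 + k' * n) ≤ (m + n) * (1 + k) * (1 + k') := by
          calc (m + k * m) * (1 + k' * n) = m * (1 + k) * (1 + k' * n) := by ring
            _ ≤ (m + n) * (1 + k) * (1 + k' * 1) := by gcongr; linarith
            _ = _ := by ring
        linarith
    _ = 2 * (((k + k' + k * k') + (1 + k) * (1 + k')) * (m + n)) := by ring
    _ ≤ 2 * (((k + k' + k * k') + (1 + k) * (1 + k')) * ((K₂ + 1) * (q + n))) := by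
        have : m + n ≤ (K₂ + 1) * (q + n) := by
          have := mul_nonneg hK₂ hn0.le
          rw [add_mul, mul_add]
          linarith
        gcongr
    _ = _ := by ring

lemma exists_imprecisionFactor_eq {c β κ : ℝ} (hc : 0 < c) (hβ' : β < 0) (hκ : 0 < κ) :
    ∃ K : ℝ, 0 ≤ K ∧ ∀ d : ℕ, Odd d → ∃ ε : ℝ,
      |ε| ≤ K * Real.exp (-(κ * (d : ℝ) ^ (1 / 2 + β))) ∧
      imprecisionFactor d (c * (d : ℝ) ^ β) =
        ((Real.exp (-(π * c / 2 * (d : ℝ) ^ (β - 1))) * (1 + ε) : ℝ) : ℂ) := by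
  set k := 2 / (1 - Real.exp (-(π * (1 / (2 * c))))) with hk
  have hk0 : 0 ≤ k := by
    have : Real.exp (-(π * (1 / (2 * c)))) < 1 := Real.exp_lt_one_iff.mpr (by
      rw [neg_lt_zero]; positivity)
    exact div_nonneg zero_le_two (by linarith)
  refine ⟨2 * (k * Real.exp (κ ^ 2 / (4 * (π / (2 * c))))), by positivity, fun d hd => ?_⟩
  have hx1 : (1 : ℝ) ≤ d := by exact_mod_cast hd.pos
  have hx0 : (0 : ℝ) < d := by linarith
  have e1 : π * (c * (d : ℝ) ^ β) / (2 * d) = π * c / 2 * (d : ℝ) ^ (β - 1) := by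
    rw [Real.rpow_sub hx0, Real.rpow_one]; field_simp
  have e2 : d / (2 * (c * (d : ℝ) ^ β)) = 1 / (2 * c) * (d : ℝ) ^ (1 - β) := by
    rw [Real.rpow_sub hx0, Real.rpow_one]; field_simp
  rw [imprecisionFactor_eq hd (by positivity), e1, e2]
  have hy : (d : ℝ) ≤ (d : ℝ) ^ (1 - β) := by
    simpa using Real.rpow_le_rpow_of_exponent_le hx1 (show 1 ≤ 1 - β by linarith)
  set u := 1 / (2 * c) * (d : ℝ) ^ (1 - β) with hu
  have hu1 : 1 / (2 * c) ≤ u := le_mul_of_one_le_right (by positivity) (hx1.trans hy)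
  have hu0 : 0 < u := by positivity
  refine ⟨theta (1 / 2) u / theta 0 u - 1, ?_, by ring_nf⟩
  refine (abs_theta_half_div_sub_one_le hu0).trans ?_
  rw [mul_assoc]
  refine mul_le_mul_of_nonneg_left ((theta_zero_sub_one_le (by positivity) hu1).trans ?_)
    zero_le_two
  rw [mul_assoc]
  refine mul_le_mul_of_nonneg_left ?_ hk0
  rw [← Real.exp_add, Real.exp_le_exp]
  have h1 : (d : ℝ) ^ (1 / 2 + β) ≤ √d := by
    rw [Real.sqrt_eq_rpow]
    exact Real.rpow_le_rpow_of_exponent_le hx1 (by linarith)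
  set p := π / (2 * c) with hp
  have hp0 : 0 < p := by positivity
  have h2 : p * d ≤ π * u := by
    rw [hu, hp, ← mul_assoc, mul_one_div]; gcongr
  have h3 : √(d : ℝ) ^ 2 = d := Real.sq_sqrt hx0.le
  -- The decay of C₂ is at least e^{-pd}, much faster than the target; the inequality of the means
  -- converts it for any κ, at the cost of a constant.
  have h4 : κ * √d ≤ κ ^ 2 / (4 * p) + p * d := by
    rw [← h3]
    have : κ ^ 2 / (4 * p) + p * √(d : ℝ) ^ 2 - κ * √(√(d : ℝ) ^ 2) =
      (κ / (2 * p) - √d) ^ 2 * p := by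
      rw [Real.sqrt_sq (Real.sqrt_nonneg _)]; field_simp; ring
    nlinarith [mul_nonneg (sq_nonneg (κ / (2 * p) - √(d : ℝ))) hp0.le]
  have h5 : κ * (d : ℝ) ^ (1 / 2 + β) ≤ κ * √d := by gcongr
  linarith

lemma norm_mul_three_sub_one_le {a b c : ℂ} {M₁ M₂ : ℝ} (ha : ‖a‖ ≤ M₁) (hb : ‖b‖ ≤ M₂) :
    ‖(1 + a) * (1 + b) * c - 1‖ ≤ (1 + M₁) * (1 + M₂) * ‖c - 1‖ + (1 + M₁) * ‖b‖ + ‖a‖ := by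
  have e : (1 + a) * (1 + b) * c - 1 = (1 + a) * (1 + b) * (c - 1) + (1 + a) * b + a := by ring
  have h1 : ‖1 + a‖ ≤ 1 + M₁ := (norm_add_le _ _).trans (by rw [norm_one]; linarith)
  have h2 : ‖1 + b‖ ≤ 1 + M₂ := (norm_add_le _ _).trans (by rw [norm_one]; linarith)
  have h3 : 0 ≤ 1 + M₁ := (norm_nonneg _).trans h1
  rw [e]
  refine (norm_add_le _ _).trans (add_le_add_left ((norm_add_le _ _).trans ?_) _)
  rw [norm_mul, norm_mul, norm_mul]
  gcongr

lemma phase_eq (d n : ℕ) : Complex.exp (-(2 * Real.pi * I / (d : ℂ) *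
    ∑ _j ∈ Finset.Icc 1 n, ((1 / 2 : ℝ) : ℂ))) = cis (-(1 / 2 / d)) ^ n := by
  rw [cis, ← Complex.exp_nat_mul, Finset.sum_const, Nat.card_Icc, nsmul_eq_mul]
  congr 1
  push_cast [Nat.add_sub_cancel]
  ring

end Main

end QuasiIdealClock

end

theorem mainTheorem1 (c₁ c₂ α β γ t : ℝ) (hc₁ : 0 < c₁) (hc₂ : 0 < c₂)
    (hα : -1 < α) (hα' : α < 1) (hβ : -(1 / 2) < β) (hβ' : β < 0)
    (hγ : 1 / 2 < γ) (hγ' : γ < 1) (ht : 0 < t) :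
    ∃ C : ℝ, ∃ d₀ : ℕ, ∀ d : ℕ, Odd d → d₀ ≤ d →
      ∀ n₀ : ℤ, |(n₀ : ℝ)| < γ * ((d : ℝ) / 2) - 1 / 2 →
      ∀ (I J : ℕ) (_ : 2 ≤ I) (_ : (I : ℝ) ≤ t * Real.sqrt d) (_ : I ≤ J),
        let ξsq : ℝ := c₁ * (d : ℝ) ^ α
        let σsq : ℝ := c₂ * (d : ℝ) ^ β
        let δ : ℕ → ℝ := fun _ => 1 / 2
        let moment : ℂ := QuasiIdealClock.clockMoment d ξsq σsq n₀ δ J ⟨I - 1, by omega⟩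
        let phase : ℂ :=
          Complex.exp (-(2 * Real.pi * Complex.I / (d : ℂ) * ∑ j ∈ Finset.Icc 1 I, (δ j : ℂ)))
        let C₃ : ℂ := QuasiIdealClock.backactionFactor d ξsq σsq n₀ δ (I - 1)
        (∃ ε : ℂ,
          ‖ε‖ ≤ C * (QuasiIdealClock.backactionError c₁ c₂ α β γ t n₀ d +
            Real.exp (-(Real.pi / (2 * c₁)) * (d : ℝ) ^ (1 - α))) ∧
          moment = phase *
            ((Real.exp (-(Real.pi * c₁ / 2) * (d : ℝ) ^ (α - 1) -
              Real.pi * c₂ / 2 * (d : ℝ) ^ (β - 1)) : ℝ) : ℂ) * (1 + ε)) ∧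
        moment = phase * (QuasiIdealClock.waveFactor d ξsq : ℂ) *
          QuasiIdealClock.imprecisionFactor d σsq * C₃ ∧
        ‖C₃ - 1‖ ≤ C * QuasiIdealClock.backactionError c₁ c₂ α β γ t n₀ d := by
  have hγ0 : 0 < γ := by linarith
  have hκ : 0 < Real.pi * c₂ * (1 - γ) ^ 2 / (2 * t) := by
    have : 0 < 1 - γ := by linarith
    positivity
  obtain ⟨K₁, hK₁, h₁⟩ := QuasiIdealClock.exists_waveFactor_eq hc₁ hα hα'
  obtain ⟨K₂, hK₂, h₂⟩ := QuasiIdealClock.exists_imprecisionFactor_eq hc₂ hβ' hκ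
  obtain ⟨K₃, h₃⟩ := QuasiIdealClock.exists_norm_backactionFactor_sub_one_le hc₁ hc₂ hα hα' hβ hβ'
    hγ' ht
  set K := max K₃ 0 with hK
  -- The bound on ε₁ is K₁ times a sum of two terms, each at most 1.
  set M₁ := 2 * K₁ with hM₁
  refine ⟨(1 + M₁) * (1 + K₂) * K + (1 + M₁) * K₂ + K₁ + K, 4, ?_⟩
  intro d hd hd4 n₀ hn₀ n J hn hnt hnJ ξsq σsq δ moment phase C₃
  have hx1 : (1 : ℝ) ≤ d := by exact_mod_cast hd.pos
  have hx0 : (0 : ℝ) < d := by linarith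
  obtain ⟨ε₁, hε₁, hC₁⟩ := h₁ d hd hd4
  obtain ⟨ε₂, hε₂, hC₂⟩ := h₂ d hd
  have hN : ((n - 1 : ℕ) : ℝ) ≤ t * √d := by
    refine le_trans ?_ hnt
    exact_mod_cast Nat.sub_le n 1
  have hC₃ := h₃ d hd n₀ (by linarith) (n - 1) hN
  set E := QuasiIdealClock.backactionError c₁ c₂ α β γ t n₀ d with hE
  set e := Real.exp (-(Real.pi / (2 * c₁)) * (d : ℝ) ^ (1 - α)) with he
  have he0 : 0 ≤ e := (Real.exp_pos _).le
  have hmoment : moment = phase * (QuasiIdealClock.waveFactor d ξsq : ℂ) *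
      QuasiIdealClock.imprecisionFactor d σsq * C₃ := by
    have h := QuasiIdealClock.clockMoment_eq hd (ξsq := ξsq) (σsq := σsq)
      (by positivity) (by positivity) n₀ (1 / 2) (N := n - 1) (J := J) (by omega)
    rw [Nat.sub_add_cancel (by omega : 1 ≤ n), ← QuasiIdealClock.phase_eq] at h
    exact h
  set A := (d : ℝ) ^ (β / 2 + 1 / 2) *
      Real.exp (-(Real.pi * c₂ * (1 - γ) ^ 2 / (2 * t) * (d : ℝ) ^ (1 / 2 + β))) with hA
  have hE1 : E = A + (d : ℝ)⁻¹ * Real.exp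
      (-(Real.pi * c₁ * (γ - 2 * |(n₀ : ℝ)| / d) ^ 2 / 4 * (d : ℝ) ^ (1 + α))) := by
    rw [hE, QuasiIdealClock.backactionError, Real.rpow_neg_one, neg_mul, neg_mul]
  -- With the square at most 1, the n₀-free error of C₁ is below the second term of E_d.
  have hsq : (γ - 2 * |(n₀ : ℝ)| / d) ^ 2 ≤ 1 := by
    have h1 : 2 * |(n₀ : ℝ)| / d ≤ γ := by rw [div_le_iff₀ hx0]; linarith
    have h2 : 0 ≤ 2 * |(n₀ : ℝ)| / d := by positivity
    exact pow_le_one₀ (by linarith) (by linarith)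
  have hq : (d : ℝ)⁻¹ * Real.exp (-(Real.pi * c₁ / 4 * (d : ℝ) ^ (1 + α))) ≤ (d : ℝ)⁻¹ * Real.exp
      (-(Real.pi * c₁ * (γ - 2 * |(n₀ : ℝ)| / d) ^ 2 / 4 * (d : ℝ) ^ (1 + α))) := by
    have : 0 < Real.pi * c₁ := by positivity
    have := mul_le_of_le_one_right this.le hsq
    gcongr
  have hA0 : 0 ≤ A := by positivity
  have hA1 : Real.exp (-(Real.pi * c₂ * (1 - γ) ^ 2 / (2 * t) * (d : ℝ) ^ (1 / 2 + β))) ≤ A :=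
    le_mul_of_one_le_left (Real.exp_pos _).le (Real.one_le_rpow hx1 (by linarith))
  have hq0 : 0 ≤ (d : ℝ)⁻¹ * Real.exp (-(Real.pi * c₁ / 4 * (d : ℝ) ^ (1 + α))) := by positivity
  have hE0 : 0 ≤ E := by linarith
  have hε₁' : |ε₁| ≤ K₁ * (E + e) := by
    refine hε₁.trans (mul_le_mul_of_nonneg_left ?_ hK₁)
    rw [he, neg_mul]
    linarith
  have hε₁M : |ε₁| ≤ M₁ := by
    refine hε₁.trans ?_
    rw [hM₁, mul_comm 2 K₁]
    refine mul_le_mul_of_nonneg_left ?_ hK₁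
    have h1 : (d : ℝ)⁻¹ * Real.exp (-(Real.pi * c₁ / 4 * (d : ℝ) ^ (1 + α))) ≤ 1 :=
      mul_le_one₀ (inv_le_one_of_one_le₀ hx1) (Real.exp_pos _).le
        (Real.exp_le_one_iff.mpr (by rw [neg_nonpos]; positivity))
    have h2 : Real.exp (-(Real.pi / (2 * c₁) * (d : ℝ) ^ (1 - α))) ≤ 1 :=
      Real.exp_le_one_iff.mpr (by rw [neg_nonpos]; positivity)
    linarith
  have hε₂' : |ε₂| ≤ K₂ * (E + e) :=
    hε₂.trans (mul_le_mul_of_nonneg_left (by linarith) hK₂)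
  have hε₂M : |ε₂| ≤ K₂ := hε₂.trans (mul_le_of_le_one_right hK₂
    (Real.exp_le_one_iff.mpr (by rw [neg_nonpos]; positivity)))
  have hK0 : 0 ≤ K := le_max_right _ _
  have hM0 : 0 ≤ M₁ := by positivity
  have hC₃' : ‖C₃ - 1‖ ≤ K * E :=
    hC₃.trans (mul_le_mul_of_nonneg_right (le_max_left _ _) hE0)
  -- The total relative error combines those of the three factors.
  refine ⟨⟨(1 + (ε₁ : ℂ)) * (1 + (ε₂ : ℂ)) * C₃ - 1, ?_, ?_⟩, hmoment, hC₃'.trans ?_⟩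
  · have h := QuasiIdealClock.norm_mul_three_sub_one_le (a := (ε₁ : ℂ)) (b := (ε₂ : ℂ)) (c := C₃)
      (M₁ := M₁) (M₂ := K₂) (by rwa [Complex.norm_real]) (by rwa [Complex.norm_real])
    rw [Complex.norm_real, Complex.norm_real, Real.norm_eq_abs, Real.norm_eq_abs] at h
    refine h.trans ?_
    have hC₃'' : ‖C₃ - 1‖ ≤ K * (E + e) :=
      hC₃'.trans (mul_le_mul_of_nonneg_left (by linarith) hK0)
    calc _ ≤ (1 + M₁) * (1 + K₂) * (K * (E + e)) + (1 + M₁) * (K₂ * (E + e)) + K₁ * (E + e) := by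
          gcongr
      _ = ((1 + M₁) * (1 + K₂) * K + (1 + M₁) * K₂ + K₁) * (E + e) := by ring
      _ ≤ _ := mul_le_mul_of_nonneg_right (by linarith) (by linarith)
  · rw [hmoment, hC₁, hC₂, sub_eq_add_neg (-(_ / 2) * _), Real.exp_add, neg_mul]
    push_cast
    ring
  · refine mul_le_mul_of_nonneg_right ?_ hE0
    have : 0 ≤ (1 + M₁) * (1 + K₂) * K + (1 + M₁) * K₂ + K₁ := by positivity
    linarith
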